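/- **Setting.** Let $d\ge 1$, $q>1$, $N_1>1$ and $C\in\mathbb R$. Let $(\omega_{x,t})_{(x,t)\in\mathbb R^d\times\mathbb R}$ be a random field with values in a measurable space $\Omega_0$, defined on a probability space $(\Omega,\mathscr F,\mathbb P)$, whose law on $\Omega_0^{\mathbb R^{d}\times\mathbb R}$ is stationary and ergodic under all space-time shifts and such that, for every $a\in\mathbb R$, the families $\{\omega_{x,t}:t\le a\}$ and $\{\omega_{x,t}:t\ge a+1\}$ are independent. Let $H:\mathbb R^d\times\Omega_0\to\mathbb R$ be convex in its first variable with a real-valued Legendre transform $L(v,a)=\sup_{p\in\mathbb R^d}(p\cdot v-H(p,a))$, and write $H(x,t,p,\omega)=H(p,\omega_{x,t})$ and $L(x,t,v,\omega)=L(v,\omega_{x,t})$. Let $\nu$ be a function of the time slice of the field with values in $[1,\infty)$, and put $\nu_t=\nu((\omega_{x,t})_{x\in\mathbb R^d})$. Assume that, almost surely, $t\mapsto\nu_t$ is locally integrable, $L(\cdot,\cdot,\cdot,\omega)$ is bounded and uniformly continuous on $\mathbb R^d\times\mathbb R\times B(0,R)$ for every $R>0$, and for all $x,y,v,w\in\mathbb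 R^d$ and $s,t\in\mathbb R$ $$\tfrac1{N_1}|v|^q-\nu_t\le L(x,t,v,\omega)\le N_1|v|^q+\nu_t,$$ $$|L(x,t,v,\omega)-L(y,s,w,\omega)|\le C|v-w|\left(|v|^{q-1}+|w|^{q-1}+1\right)+\nu_s+\nu_t .$$ By the solution $u$ of $$u_t+H(x,t,Du,\omega)=0\ \text{ in }\mathbb R^d\times(0,\infty),\qquad u(\cdot,0)=0\ \text{ on }\mathbb R^d,$$ we mean the viscosity solution that is continuous on $\mathbb R^d\times[0,\infty)$ and bounded on $\mathbb R^d\times[0,T]$ for every $T>0$. **Theorem.** There are a constant $K>0$ depending only on $d,N_1$ and constants $c_1,K_q>0$ depending only on $d,N_1,q,C$ such that the following holds. Put $$\varphi(r)=\exp\left(c_1(\log r)^{1/\min(2,q)}\right)\ (r\ge1),\qquad \tau_{x,y,t}=|x-y|\,\varphi\left(\tfrac{t+|x-y|}{|x-y|}\right),\qquad \tilde\tau_{t,s}=(t-s)\,\varphi\left(\tfrac{t}{t-s}\right),$$ $$\mathfrak C_t=\left(4N_1\,\frac1t\int_0^t\nu_r\,dr\right)^{1/q}.$$ Almost surely, for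 all $x,y\in\mathbb R^d$ with $x\ne y$ and all $t>0$, $$|u(x,t)-u(y,t)|\le K_q\,|x-y|\,\varphi\left(\tfrac{t+|x-y|}{|x-y|}\right)\left(\mathfrak C_t^q+\sup_{w\le t-\tau_{x,y,t}}\frac1{t-w\vee0}\int_{w\vee 0}^t\nu_r\,dr\right),$$ and for all $x\in\mathbb R^d$ and $0<s<t$, $$-\int_s^t\nu_r\,dr\le u(x,s)-u(x,t)\le K\,(t-s)\,\varphi\left(\tfrac{t}{t-s}\right)\left(\tfrac ts\right)^{q-1}\left(\mathfrak C_t^q+\sup_{w\le t-\tilde\tau_{t,s}}\frac1{t-w\vee0}\int_{w\vee0}^t\nu_r\,dr\right).$$ -/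

import Mathlib

open MeasureTheory ProbabilityTheory Set

noncomputable section

namespace HJ

/-- Euclidean space `ℝ^d`. -/
abbrev Space (d : ℕ) : Type := EuclideanSpace ℝ (Fin d)

/-- Environments: space-time configurations `(x, t) ↦ ω_{x,t}` with values in the state space. -/
abbrev Env (d : ℕ) (Ω₀ : Type*) : Type _ := Space d × ℝ → Ω₀

/-- The space-time shift `(T_z ω)_y = ω_{y + z}`. -/
def shift {d : ℕ} {Ω₀ : Type*} (z : Space d × ℝ) (e : Env d Ω₀) : Env d Ω₀ :=
  fun y => e (y + z)

/-- `X` is a random field on `ℝ^d × ℝ`, defined on a probability space `(Ω, P)`, whose law is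
stationary and ergodic under space-time shifts and which has unit range of dependence in time.
(The canonical case is `Ω = Env d Ω₀` with `X` the identity.) -/
structure IsStationaryErgodicUnitRange {d : ℕ} {Ω Ω₀ : Type*} [MeasurableSpace Ω]
    [MeasurableSpace Ω₀] (P : Measure Ω) (X : Ω → Env d Ω₀) : Prop where
  measurable : Measurable X
  stationary : ∀ z : Space d × ℝ, MeasurePreserving (shift z) (P.map X) (P.map X)
  ergodic : ∀ U : Set (Env d Ω₀), MeasurableSet U → (∀ z : Space d × ℝ, shift z '' U = U) →
    P.map X U = 0 ∨ P.map X U = 1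
  unit_range : ∀ a : ℝ,
    IndepFun (fun (ω : Ω) (z : {z : Space d × ℝ // z.2 ≤ a}) => X ω z)
      (fun (ω : Ω) (z : {z : Space d × ℝ // a + 1 ≤ z.2}) => X ω z) P

/-- The Lagrangian `L(v, a) = sup_p (p ⬝ v - H(p, a))`. -/
def lagrangian {d : ℕ} {Ω₀ : Type*} (H : Space d → Ω₀ → ℝ) (v : Space d) (a : Ω₀) : ℝ :=
  ⨆ p : Space d, (inner ℝ p v - H p a)

/-- `H` is convex in the momentum variable and its Legendre transform is real-valued. -/
structure IsConvexHamiltonian {d : ℕ} {Ω₀ : Type*} (H : Space d → Ω₀ → ℝ) : Prop where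
  convex : ∀ a : Ω₀, ConvexOn ℝ univ (fun p => H p a)
  finite : ∀ (a : Ω₀) (v : Space d), BddAbove (range fun p : Space d => inner ℝ p v - H p a)

/-- `ν_t`: the functional `ν` applied to the time slice `(ω_{x,t})_x` of the environment. -/
def nuAt {d : ℕ} {Ω₀ : Type*} (ν : (Space d → Ω₀) → ℝ) (e : Env d Ω₀) (t : ℝ) : ℝ :=
  ν (fun x => e (x, t))

/-- The standing conditions on `L(x, t, v) = L(v, e_{x,t})` for one environment `e`: bounded and
uniformly continuous for velocities in each ball, growth of order `q`, and regularity, with an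
error term `t ↦ ν_t` that is locally integrable. -/
structure LagrangianCond {d : ℕ} {Ω₀ : Type*} (H : Space d → Ω₀ → ℝ)
    (ν : (Space d → Ω₀) → ℝ) (q N₁ C : ℝ) (e : Env d Ω₀) : Prop where
  bounded : ∀ R : ℝ, 0 < R → ∃ M : ℝ, ∀ (x : Space d) (t : ℝ), ∀ v ∈ Metric.ball (0 : Space d) R,
    |lagrangian H v (e (x, t))| ≤ M
  uniformContinuous : ∀ R : ℝ, 0 < R →
    UniformContinuousOn (fun z : (Space d × ℝ) × Space d => lagrangian H z.2 (e z.1))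
      (univ ×ˢ Metric.ball (0 : Space d) R)
  lower : ∀ (x : Space d) (t : ℝ) (v : Space d),
    1 / N₁ * ‖v‖ ^ q - nuAt ν e t ≤ lagrangian H v (e (x, t))
  upper : ∀ (x : Space d) (t : ℝ) (v : Space d),
    lagrangian H v (e (x, t)) ≤ N₁ * ‖v‖ ^ q + nuAt ν e t
  regularity : ∀ (x : Space d) (t : ℝ) (v : Space d) (y : Space d) (s : ℝ) (w : Space d),
    |lagrangian H v (e (x, t)) - lagrangian H w (e (y, s))| ≤
      C * ‖v - w‖ * (‖v‖ ^ (q - 1) + ‖w‖ ^ (q - 1) + 1) + nuAt ν e s + nuAt ν e t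
  locallyIntegrable : LocallyIntegrable (nuAt ν e) volume

/-- `u` is a viscosity solution of `u_t + F(x, t, Du) = 0` in `ℝ^d × (0, ∞)` with `u(x, 0) = 0`:
continuous on `ℝ^d × [0, ∞)`, bounded on each strip `ℝ^d × [0, T]`, and tested from above and from
below by `C¹` functions. -/
structure IsViscositySolution {d : ℕ} (F : Space d → ℝ → Space d → ℝ)
    (u : Space d → ℝ → ℝ) : Prop where
  continuousOn : ContinuousOn (fun z : Space d × ℝ => u z.1 z.2) (univ ×ˢ Ici 0)
  bounded : ∀ T : ℝ, ∃ M : ℝ, ∀ (x : Space d), ∀ t ∈ Icc 0 T, |u x t| ≤ M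
  initial : ∀ x : Space d, u x 0 = 0
  subsolution : ∀ ψ : Space d × ℝ → ℝ, ContDiff ℝ 1 ψ → ∀ (x : Space d) (t : ℝ), 0 < t →
    IsLocalMax (fun z : Space d × ℝ => u z.1 z.2 - ψ z) (x, t) →
    deriv (fun s => ψ (x, s)) t + F x t (gradient (fun y => ψ (y, t)) x) ≤ 0
  supersolution : ∀ ψ : Space d × ℝ → ℝ, ContDiff ℝ 1 ψ → ∀ (x : Space d) (t : ℝ), 0 < t →
    IsLocalMin (fun z : Space d × ℝ => u z.1 z.2 - ψ z) (x, t) →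
    0 ≤ deriv (fun s => ψ (x, s)) t + F x t (gradient (fun y => ψ (y, t)) x)

/-- `φ(s) = exp (c₁ (log s)^{1 / (2 ∧ q)})`, used for `s ≥ 1`. -/
def phi (c₁ q s : ℝ) : ℝ := Real.exp (c₁ * Real.log s ^ (1 / min 2 q))

/-- `τ_{x,y,t} = |x - y| φ((t + |x - y|) / |x - y|)`. -/
def tauSpace {d : ℕ} (c₁ q : ℝ) (x y : Space d) (t : ℝ) : ℝ :=
  ‖x - y‖ * phi c₁ q ((t + ‖x - y‖) / ‖x - y‖)

/-- `τ̃_{t,s} = (t - s) φ(t / (t - s))`. -/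
def tauTime (c₁ q t s : ℝ) : ℝ := (t - s) * phi c₁ q (t / (t - s))

/-- The velocity cutoff `𝔠_t = (4 N₁ ⨍_0^t n_r dr)^{1/q}`. -/
def cutoff (N₁ q : ℝ) (n : ℝ → ℝ) (t : ℝ) : ℝ :=
  (4 * N₁ * ⨍ r in (0 : ℝ)..t, n r) ^ (1 / q)

/-- `sup_{w ≤ b} ⨍_{w ∨ 0}^t n_r dr`. -/
def supAverage (n : ℝ → ℝ) (b t : ℝ) : ℝ :=
  ⨆ w : Iic b, ⨍ r in (max (w : ℝ) 0)..t, n r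

end HJ

end

/-! ### Convex duality in a fixed environment -/

namespace HJ

open Filter Topology

/-! The estimates are proved pathwise, in one environment satisfying `LagrangianCond`. There a
viscosity solution obeys both halves of the dynamic programming principle. Along a piecewise affine
path it grows by at most the action (`IsViscositySolution.le_add_integral`). Conversely, for every
`(x, t)` with `t > 0`, some such path on `[0, t]` ending at `x` has action below `u x t + ε`
(`exists_action_lt`, from the comparison principle `value_le`). Since the error `n = ν` is only
integrable in time, comparison must absorb it in `L¹` rather than pointwise.

Regularity comes from bending paths. Give the velocity `α` of an almost optimal path a constant
extra drift on a window before its end, so that it reaches `y` at time `t`, or reaches `x` already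
at time `s`. Displacing the path costs only a multiple of `∫ n`, whereas a drift of size `k` costs
about `k ∫ ‖α‖^(q-1)` (`le_add_drift`). What is needed is a bound for the energy `∫ ‖α‖^q` on short
final windows.

This bound also comes from bending. Reaching `x` at time `t - σ`, with the detour spread over the
preceding time `ρ σ`, saves the energy of the last `σ` units; Young's inequality absorbs the drift
cost into half of it (`le_add_of_earlier`). Hence a bound for the mean energy at scale `(ρ + 1) σ`
gives one at scale `σ`, larger by a constant factor `g` (`energy_le_pow`). The trivial bound at the
top scale costs a factor `ρ`, and `j` iterations cost `g^j`, where `(ρ + 1)^j` must exceed `t / σ`.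
Taking `log ρ` and `j` of order `√(log (t / σ))` balances the two and yields `exp (c √log)`
(`energy_le_exp`), which lies below `φ` because `1 / min 2 q ≥ 1 / 2`. On a window of length `τ = ‖x
- y‖ φ` or `(t - s) φ`, the factor `φ` in the energy cancels against the small drift, so the total
cost is of order `τ` times the averages of `n`. -/

/-- `F` and `G` are a convex-dual Lagrangian-Hamiltonian pair in space-time, and `F` has the
growth and the regularity of the standing conditions with error term `n`. -/
structure IsDualPair {d : ℕ} (F G : Space d × ℝ → Space d → ℝ) (n : ℝ → ℝ) (q N₁ C : ℝ) :
    Prop where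
  bounded : ∀ R : ℝ, 0 < R → ∃ M : ℝ, ∀ z : Space d × ℝ, ∀ v : Space d, ‖v‖ < R → |F z v| ≤ M
  uniformContinuous : ∀ R : ℝ, 0 < R → ∀ ε : ℝ, 0 < ε → ∃ δ : ℝ, 0 < δ ∧
    ∀ (z z' : Space d × ℝ) (v v' : Space d), ‖v‖ < R → ‖v'‖ < R → dist z z' < δ → dist v v' < δ →
      |F z v - F z' v'| < ε
  lower : ∀ (z : Space d × ℝ) (v : Space d), 1 / N₁ * ‖v‖ ^ q - n z.2 ≤ F z v
  upper : ∀ (z : Space d × ℝ) (v : Space d), F z v ≤ N₁ * ‖v‖ ^ q + n z.2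
  regularity : ∀ (z z' : Space d × ℝ) (v w : Space d),
    |F z v - F z' w| ≤ C * ‖v - w‖ * (‖v‖ ^ (q - 1) + ‖w‖ ^ (q - 1) + 1) + n z'.2 + n z.2
  star : ∀ (z : Space d × ℝ) (v : Space d) (c : ℝ), 0 ≤ c → c ≤ 1 →
    F z (c • v) ≤ (1 - c) * F z 0 + c * F z v
  young : ∀ (z : Space d × ℝ) (p v : Space d), inner ℝ p v - F z v ≤ G z p
  exists_velocity : ∀ (z : Space d × ℝ) (p : Space d) (a : ℝ), a < G z p →
    ∃ v : Space d, a ≤ inner ℝ p v - F z v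
  one_le : ∀ t : ℝ, 1 ≤ n t
  locallyIntegrable : LocallyIntegrable n volume

theorem inner_sub_le_lagrangian {d : ℕ} {Ω₀ : Type*} {H : Space d → Ω₀ → ℝ}
    (hH : IsConvexHamiltonian H) (p v : Space d) (a : Ω₀) :
    inner ℝ p v - H p a ≤ lagrangian H v a :=
  le_ciSup (hH.finite a v) p

/-- This is Fenchel–Moreau duality. A finite convex function on Euclidean space is continuous, so
any level below its value at `p` is exceeded at `p` by some affine minorant. The slope of that
minorant is the velocity, and its constant term bounds the conjugate there. -/
theorem exists_velocity_of_lt {d : ℕ} {Ω₀ : Type*} {H : Space d → Ω₀ → ℝ}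
    (hH : IsConvexHamiltonian H) (p : Space d) (a : Ω₀) {b : ℝ} (hb : b < H p a) :
    ∃ v : Space d, b ≤ inner ℝ p v - lagrangian H v a := by
  have hc : Continuous fun p => H p a := by
    have := (hH.convex a).continuousOn isOpen_univ
    rwa [continuousOn_univ] at this
  obtain ⟨l, c, hl, hlp⟩ := (hH.convex a).exists_affine_le_of_lt (𝕜 := ℝ) (mem_univ p) hb
    isClosed_univ (hc.lowerSemicontinuous.lowerSemicontinuousOn _)
  set v := (InnerProductSpace.toDual ℝ (Space d)).symm l with hv
  have hin : ∀ y, inner ℝ y v = l y := fun y => by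
    rw [real_inner_comm, hv, InnerProductSpace.toDual_symm_apply]
  refine ⟨v, ?_⟩
  have hle : lagrangian H v a ≤ -c := by
    refine ciSup_le fun y => ?_
    have := hl ⟨y, mem_univ y⟩
    simp at this
    rw [hin]
    linarith
  simp at hlp
  rw [hin]
  linarith

/-- A supremum of affine functions of `v` is convex. Only convexity along rays from the origin is
used later, to spread growth from a sphere to its exterior. -/
theorem lagrangian_smul_le {d : ℕ} {Ω₀ : Type*} {H : Space d → Ω₀ → ℝ}
    (hH : IsConvexHamiltonian H) (v : Space d) (a : Ω₀) {c : ℝ} (h0 : 0 ≤ c) (h1 : c ≤ 1) :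
    lagrangian H (c • v) a ≤ (1 - c) * lagrangian H 0 a + c * lagrangian H v a := by
  refine ciSup_le fun p => ?_
  have e1 := inner_sub_le_lagrangian hH p 0 a
  have e2 := inner_sub_le_lagrangian hH p v a
  rw [inner_zero_right] at e1
  rw [inner_smul_right]
  nlinarith [mul_le_mul_of_nonneg_left e1 (sub_nonneg.2 h1), mul_le_mul_of_nonneg_left e2 h0]

theorem LagrangianCond.isDualPair {d : ℕ} {Ω₀ : Type*} {H : Space d → Ω₀ → ℝ}
    {ν : (Space d → Ω₀) → ℝ} {q N₁ C : ℝ} {e : Env d Ω₀} (h : LagrangianCond H ν q N₁ C e)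
    (hH : IsConvexHamiltonian H) (hν : ∀ η, 1 ≤ ν η) :
    IsDualPair (fun z v => lagrangian H v (e z)) (fun z p => H p (e z)) (nuAt ν e) q N₁ C where
  bounded R hR := by
    obtain ⟨M, hM⟩ := h.bounded R hR
    exact ⟨M, fun z v hv => hM z.1 z.2 v (by simpa using hv)⟩
  uniformContinuous R hR ε hε := by
    obtain ⟨δ, hδ, H'⟩ := Metric.uniformContinuousOn_iff.1 (h.uniformContinuous R hR) ε hε
    refine ⟨δ, hδ, fun z z' v v' hv hv' hz hvv => ?_⟩
    have := H' (z, v) ⟨mem_univ _, by simpa using hv⟩ (z', v') ⟨mem_univ _, by simpa using hv'⟩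
      (max_lt hz hvv)
    simpa [Real.dist_eq] using this
  lower z v := h.lower z.1 z.2 v
  upper z v := h.upper z.1 z.2 v
  regularity z z' v w := h.regularity z.1 z.2 v z'.1 z'.2 w
  star z v c h0 h1 := lagrangian_smul_le hH v _ h0 h1
  young z p v := by
    have := inner_sub_le_lagrangian hH p v (e z)
    linarith
  exists_velocity z p a ha := exists_velocity_of_lt hH p _ ha
  one_le t := hν _
  locallyIntegrable := h.locallyIntegrable

namespace IsDualPair

variable {d : ℕ} {F G : Space d × ℝ → Space d → ℝ} {n : ℝ → ℝ} {q N₁ C : ℝ}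

theorem continuous (h : IsDualPair F G n q N₁ C) :
    Continuous fun y : (Space d × ℝ) × Space d => F y.1 y.2 := by
  rw [Metric.continuous_iff]
  intro y ε hε
  obtain ⟨δ, hδ, H⟩ := h.uniformContinuous (‖y.2‖ + 1) (by positivity) ε hε
  refine ⟨min δ 1, by positivity, fun y' hy' => ?_⟩
  rw [Prod.dist_eq, max_lt_iff, lt_min_iff, lt_min_iff] at hy'
  rw [Real.dist_eq]
  refine H _ _ _ _ ?_ (by linarith) hy'.1.1 hy'.2.1
  have h1 := hy'.2.2
  rw [dist_eq_norm] at h1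
  have : ‖y'.2‖ ≤ ‖y'.2 - y.2‖ + ‖y.2‖ := by simpa using norm_add_le (y'.2 - y.2) y.2
  linarith

theorem nonneg (h : IsDualPair F G n q N₁ C) (t : ℝ) : 0 ≤ n t :=
  zero_le_one.trans (h.one_le t)

theorem intervalIntegrable (h : IsDualPair F G n q N₁ C) (a b : ℝ) :
    IntervalIntegrable n volume a b :=
  (h.locallyIntegrable.integrableOn_isCompact isCompact_uIcc).intervalIntegrable

/-- At a fixed point of space-time the Lagrangian grows faster than any affine function of the
speed; by convexity this persists in a neighbourhood. -/
theorem eventually_norm_lt (h : IsDualPair F G n q N₁ C) (hN : 0 < N₁) (hq : 1 < q)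
    (z : Space d × ℝ) (a : ℝ) {b : ℝ} (hb : 0 ≤ b) : ∃ R : ℝ, 0 < R ∧
      ∀ᶠ z' in 𝓝 z, ∀ v : Space d, F z' v ≤ a * ‖v‖ + b → ‖v‖ < R := by
  obtain ⟨M, hM⟩ := h.bounded 1 one_pos
  have hM0 : 0 ≤ M := (abs_nonneg _).trans (hM z 0 (by simp))
  have htend : Tendsto (fun R : ℝ => R * (1 / N₁ * R ^ (q - 1) - a)) atTop atTop := by
    refine tendsto_id.atTop_mul_atTop₀ ?_
    refine tendsto_atTop_add_const_right _ _ ?_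
    exact (tendsto_rpow_atTop (by linarith)).const_mul_atTop (by positivity)
  -- On the sphere of radius `R` the growth bound at `z` exceeds the affine function by more than
  -- every error below.
  obtain ⟨R, hR1, hR⟩ := ((tendsto_atTop.1 htend (M + b + n z.2 + 1)).and
    (eventually_ge_atTop 1)).exists
  have hR0 : 0 < R := by linarith
  -- The growth bound is used only at `z`, because `n` may be unbounded near the time of `z`.
  -- Uniform continuity carries it to `z'` on the sphere, and `star` carries it outwards.
  obtain ⟨δ, hδ, hu⟩ := h.uniformContinuous (R + 1) (by linarith) 1 one_pos
  refine ⟨R, hR0, ?_⟩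
  filter_upwards [Metric.ball_mem_nhds z hδ] with z' hz' v hv
  by_contra! hvR
  have hv0 : 0 < ‖v‖ := by linarith
  have e1 := h.star z' v (R / ‖v‖) (by positivity) ((div_le_one hv0).2 hvR)
  have hn : ‖(R / ‖v‖) • v‖ = R := by
    rw [norm_smul, Real.norm_of_nonneg (by positivity)]; field_simp
  have e2 := hu z' z ((R / ‖v‖) • v) ((R / ‖v‖) • v) (by linarith) (by linarith) hz'
    (by simpa using hδ)
  have e3 := h.lower z ((R / ‖v‖) • v)
  rw [hn] at e3
  have e4 : R / ‖v‖ * F z' v ≤ R * a + b := by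
    calc R / ‖v‖ * F z' v ≤ R / ‖v‖ * (a * ‖v‖ + b) := by gcongr
      _ = R * a + R / ‖v‖ * b := by field_simp
      _ ≤ R * a + 1 * b := by gcongr; exact (div_le_one hv0).2 hvR
      _ = _ := by ring
  have e5 : (1 - R / ‖v‖) * F z' 0 ≤ M := by
    have h1 : 0 ≤ 1 - R / ‖v‖ := sub_nonneg.2 ((div_le_one hv0).2 hvR)
    have h2 : 1 - R / ‖v‖ ≤ 1 := by
      have : 0 ≤ R / ‖v‖ := by positivity
      linarith
    have := hM z' 0 (by simp)
    calc (1 - R / ‖v‖) * F z' 0 ≤ (1 - R / ‖v‖) * M := by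
          gcongr; exact (le_abs_self _).trans this
      _ ≤ 1 * M := by gcongr
      _ = M := one_mul _
  have e6 : R ^ q = R * R ^ (q - 1) := by
    rw [← Real.rpow_one_add' hR0.le (by linarith)]; ring_nf
  rw [e6] at e3
  rw [abs_lt] at e2
  nlinarith [e2.1, e2.2]

/-- Almost optimal velocities for nearby points and momenta stay in a fixed ball by
`eventually_norm_lt`. There `F` is uniformly continuous, so they are almost admissible in `young` at
`(z, p)`. This permits the passage to the limit in the comparison principle. -/
theorem hamiltonian_upperSemicontinuous (h : IsDualPair F G n q N₁ C) (hN : 0 < N₁) (hq : 1 < q)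
    (z : Space d × ℝ) (p : Space d) {ε : ℝ} (hε : 0 < ε) :
    ∀ᶠ y in 𝓝 (z, p), G y.1 y.2 < G z p + ε := by
  -- The slope is `‖p‖ + 1` because the momenta considered lie within distance 1 of `p`.
  obtain ⟨R, hR, hev⟩ := h.eventually_norm_lt hN hq z (‖p‖ + 1) (abs_nonneg (G z p))
  obtain ⟨δ, hδ, hu⟩ := h.uniformContinuous R hR (ε / 4) (by positivity)
  have hz : Tendsto (fun y : (Space d × ℝ) × Space d => y.1) (𝓝 (z, p)) (𝓝 z) :=
    continuous_fst.continuousAt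
  have hp : Tendsto (fun y : (Space d × ℝ) × Space d => y.2) (𝓝 (z, p)) (𝓝 p) :=
    continuous_snd.continuousAt
  have hm : 0 < min 1 (ε / (4 * R)) := by positivity
  filter_upwards [hz.eventually hev, hz.eventually (Metric.ball_mem_nhds z hδ),
    hp.eventually (Metric.ball_mem_nhds p hm)] with y hy1 hy2 hy3
  by_contra! hge
  obtain ⟨v, hv⟩ := h.exists_velocity y.1 y.2 (G z p + ε / 2) (by linarith)
  rw [dist_eq_norm, lt_min_iff] at hy3
  have hip : inner ℝ y.2 v = inner ℝ p v + inner ℝ (y.2 - p) v := by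
    rw [← inner_add_left]; simp
  have hcs := real_inner_le_norm (y.2 - p) v
  have hcs' := real_inner_le_norm p v
  have hvR : ‖v‖ < R := by
    refine hy1 v ?_
    have := neg_abs_le (G z p)
    nlinarith [norm_nonneg v]
  have e1 := h.young z p v
  have e2 := (abs_lt.1 (hu y.1 z v v hvR hvR hy2 (by simpa using hδ))).1
  have e3 : ‖y.2 - p‖ * ‖v‖ ≤ ε / 4 := by
    calc ‖y.2 - p‖ * ‖v‖ ≤ ε / (4 * R) * R := by gcongr; exact hy3.2.le
      _ = ε / 4 := by field_simp
  linarith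

end IsDualPair

/-! ### Piecewise affine paths and the value function -/

/-- Piecewise constant controls with finitely many pieces. -/
inductive IsStep {d : ℕ} : (ℝ → Space d) → Prop
  | const (v : Space d) : IsStep fun _ => v
  | ite (c : ℝ) {α β : ℝ → Space d} : IsStep α → IsStep β → IsStep fun r => if r ≤ c then α r else β r

/-- The path with velocity `α` that is at `x` at time `t`. -/
noncomputable def pathTo {d : ℕ} (α : ℝ → Space d) (x : Space d) (t r : ℝ) : Space d :=
  x - ∫ s in r..t, α s

/-- The action on `[0, t]` of the path with velocity `α` that is at `x` at time `t`. -/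
noncomputable def action {d : ℕ} (F : Space d × ℝ → Space d → ℝ) (α : ℝ → Space d) (x : Space d) (t : ℝ) : ℝ :=
  ∫ r in (0 : ℝ)..t, F (pathTo α x t r, r) (α r)

/-- The least action of a path that is at `x` at time `t`. -/
noncomputable def value {d : ℕ} (F : Space d × ℝ → Space d → ℝ) (x : Space d) (t : ℝ) : ℝ :=
  ⨅ α : {α : ℝ → Space d // IsStep α}, action F α x t

namespace IsStep

variable {d : ℕ} {α β : ℝ → Space d}

theorem measurable (h : IsStep α) : Measurable α := by
  induction h with
  | const v => exact measurable_const
  | ite c _ _ h1 h2 => exact Measurable.ite measurableSet_Iic h1 h2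

theorem bounded (h : IsStep α) : ∃ R : ℝ, 0 < R ∧ ∀ r, ‖α r‖ < R := by
  induction h with
  | const v => exact ⟨‖v‖ + 1, by positivity, fun _ => by linarith⟩
  | ite c _ _ h1 h2 =>
    obtain ⟨R, hR, h1⟩ := h1
    obtain ⟨S, hS, h2⟩ := h2
    refine ⟨max R S, by positivity, fun r => ?_⟩
    dsimp only
    split_ifs
    · exact (h1 r).trans_le (le_max_left _ _)
    · exact (h2 r).trans_le (le_max_right _ _)

theorem add (h : IsStep α) (h' : IsStep β) : IsStep fun r => α r + β r := by
  induction h with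
  | const v =>
    induction h' with
    | const w => exact IsStep.const _
    | ite c _ _ h1 h2 =>
      convert IsStep.ite c h1 h2 using 2 with r
      by_cases hr : r ≤ c <;> simp [hr]
  | ite c _ _ h1 h2 =>
    convert IsStep.ite c h1 h2 using 2 with r
    by_cases hr : r ≤ c <;> simp [hr]

theorem intervalIntegrable (h : IsStep α) (a b : ℝ) : IntervalIntegrable α volume a b := by
  obtain ⟨R, -, hR⟩ := h.bounded
  refine (intervalIntegrable_const (c := R)).mono_fun h.measurable.aestronglyMeasurable ?_
  exact ae_of_all _ fun r => (hR r).le.trans (le_abs_self R)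

theorem intervalIntegrable_norm_rpow (h : IsStep α) {p : ℝ} (hp : 0 ≤ p) (a b : ℝ) :
    IntervalIntegrable (fun r => ‖α r‖ ^ p) volume a b := by
  obtain ⟨R, hR0, hR⟩ := h.bounded
  refine (intervalIntegrable_const (c := R ^ p)).mono_fun
    (h.measurable.norm.pow_const p).aestronglyMeasurable ?_
  refine ae_of_all _ fun r => ?_
  dsimp only
  rw [Real.norm_of_nonneg (by positivity), Real.norm_of_nonneg (by positivity)]
  exact Real.rpow_le_rpow (norm_nonneg _) (hR r).le hp

theorem continuous_primitive (h : IsStep α) (a : ℝ) : Continuous fun r => ∫ s in a..r, α s :=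
  intervalIntegral.continuous_primitive (fun a b => h.intervalIntegrable a b) a

theorem pathTo_eq (h : IsStep α) (x : Space d) (t r : ℝ) :
    pathTo α x t r = (x - ∫ s in (0 : ℝ)..t, α s) + ∫ s in (0 : ℝ)..r, α s := by
  have := intervalIntegral.integral_add_adjacent_intervals (h.intervalIntegrable 0 r)
    (h.intervalIntegrable r t)
  rw [pathTo, ← this]; abel

theorem continuous_pathTo (h : IsStep α) (x : Space d) (t : ℝ) : Continuous (pathTo α x t) := by
  have : pathTo α x t = fun r => (x - ∫ s in (0 : ℝ)..t, α s) + ∫ s in (0 : ℝ)..r, α s :=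
    funext fun r => h.pathTo_eq x t r
  rw [this]
  exact continuous_const.add (h.continuous_primitive 0)

theorem pathTo_sub (h : IsStep α) (x : Space d) (t r s : ℝ) :
    pathTo α x t r - pathTo α x t s = ∫ τ in s..r, α τ := by
  rw [h.pathTo_eq, h.pathTo_eq, ← intervalIntegral.integral_interval_sub_left
    (h.intervalIntegrable 0 r) (h.intervalIntegrable 0 s)]
  abel

end IsStep

theorem pathTo_self {d : ℕ} (α : ℝ → Space d) (x : Space d) (t : ℝ) : pathTo α x t t = x := by
  simp [pathTo]

namespace IsDualPair

variable {d : ℕ} {F G : Space d × ℝ → Space d → ℝ} {n : ℝ → ℝ} {q N₁ C : ℝ} {α : ℝ → Space d}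

theorem intervalIntegrable_comp (h : IsDualPair F G n q N₁ C) (hα : IsStep α) {γ : ℝ → Space d}
    (hγ : Continuous γ) (a b : ℝ) :
    IntervalIntegrable (fun r => F (γ r, r) (α r)) volume a b := by
  obtain ⟨R, hR0, hR⟩ := hα.bounded
  obtain ⟨M, hM⟩ := h.bounded R hR0
  refine (intervalIntegrable_const (c := M)).mono_fun ?_ ?_
  · refine Measurable.aestronglyMeasurable ?_
    exact h.continuous.measurable.comp ((hγ.measurable.prodMk measurable_id).prodMk hα.measurable)
  · exact ae_of_all _ fun r => (hM _ _ (hR r)).trans (le_abs_self M)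

theorem neg_integral_le_action (h : IsDualPair F G n q N₁ C) (hN : 0 < N₁) (hα : IsStep α)
    (x : Space d) {t : ℝ} (ht : 0 ≤ t) : -(∫ r in (0 : ℝ)..t, n r) ≤ action F α x t := by
  rw [← intervalIntegral.integral_neg]
  refine intervalIntegral.integral_mono_on ht (h.intervalIntegrable 0 t).neg
    (h.intervalIntegrable_comp hα (hα.continuous_pathTo x t) 0 t) fun r _ => ?_
  have := h.lower (pathTo α x t r, r) (α r)
  have h2 : 0 ≤ 1 / N₁ * ‖α r‖ ^ q := by positivity
  dsimp only at this
  linarith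

theorem bddBelow_action (h : IsDualPair F G n q N₁ C) (hN : 0 < N₁) (x : Space d) {t : ℝ}
    (ht : 0 ≤ t) :
    BddBelow (range fun α : {α : ℝ → Space d // IsStep α} => action F α x t) := by
  refine ⟨-(∫ r in (0 : ℝ)..t, n r), ?_⟩
  rintro _ ⟨α, rfl⟩
  exact h.neg_integral_le_action hN α.2 x ht

theorem value_le_action (h : IsDualPair F G n q N₁ C) (hN : 0 < N₁) (hα : IsStep α) (x : Space d)
    {t : ℝ} (ht : 0 ≤ t) : value F x t ≤ action F α x t :=
  ciInf_le (h.bddBelow_action hN x ht) ⟨α, hα⟩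

theorem neg_integral_le_value (h : IsDualPair F G n q N₁ C) (hN : 0 < N₁) (x : Space d) {t : ℝ}
    (ht : 0 ≤ t) : -(∫ r in (0 : ℝ)..t, n r) ≤ value F x t := by
  have : Nonempty {α : ℝ → Space d // IsStep α} := ⟨⟨_, IsStep.const 0⟩⟩
  exact le_ciInf fun α => h.neg_integral_le_action hN α.2 x ht

theorem value_le_mul (h : IsDualPair F G n q N₁ C) (hN : 0 < N₁) {M : ℝ}
    (hM : ∀ z, F z 0 ≤ M) (x : Space d) {t : ℝ} (ht : 0 ≤ t) : value F x t ≤ M * t := by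
  refine (h.value_le_action hN (IsStep.const 0) x ht).trans ?_
  have : M * t = ∫ _ in (0 : ℝ)..t, M := by simp [mul_comm]
  rw [this]
  exact intervalIntegral.integral_mono_on ht
    (h.intervalIntegrable_comp (IsStep.const 0) ((IsStep.const 0).continuous_pathTo x t) 0 t)
    intervalIntegrable_const fun r _ => hM _

/-- With the control fixed, changing the end point translates the path rigidly by a continuous
amount. Velocities remain bounded, so uniform continuity of `F` controls the integrand. -/
theorem continuous_action (h : IsDualPair F G n q N₁ C) (hα : IsStep α) :
    Continuous fun z : Space d × ℝ => action F α z.1 z.2 := by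
  obtain ⟨R, hR0, hR⟩ := hα.bounded
  rw [Metric.continuous_iff']
  intro z₀ ε hε
  obtain ⟨δ, hδ, hu⟩ := h.uniformContinuous R hR0 (ε / (2 * (|z₀.2| + 1))) (by positivity)
  set A : ℝ → Space d := fun r => ∫ s in (0 : ℝ)..r, α s with hA
  have hAc : Continuous A := hα.continuous_primitive 0
  set γ : ℝ → Space d := fun r => z₀.1 - A z₀.2 + A r with hγ
  have hγc : Continuous γ := by fun_prop
  have hK : Continuous fun t => ∫ r in (0 : ℝ)..t, F (γ r, r) (α r) :=
    intervalIntegral.continuous_primitive (fun a b => h.intervalIntegrable_comp hα hγc a b) 0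
  have e1 := ((hK.comp continuous_snd).continuousAt (x := z₀)).eventually
    (Metric.ball_mem_nhds _ (half_pos hε))
  have e2 : ∀ᶠ z : Space d × ℝ in 𝓝 z₀, z.1 - A z.2 ∈ Metric.ball (z₀.1 - A z₀.2) δ :=
    ((continuous_fst.sub (hAc.comp continuous_snd)).continuousAt (x := z₀)).eventually
      (Metric.ball_mem_nhds _ hδ)
  have e3 : ∀ᶠ z : Space d × ℝ in 𝓝 z₀, |z.2| < |z₀.2| + 1 :=
    (continuous_snd.abs.continuousAt (x := z₀)).eventually_lt_const (by linarith)
  filter_upwards [e1, e2, e3] with z h1 h2 h3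
  have hz0 : action F α z₀.1 z₀.2 = ∫ r in (0 : ℝ)..z₀.2, F (γ r, r) (α r) := by
    simp only [action, hα.pathTo_eq, hγ, hA]
  have hz : action F α z.1 z.2 = ∫ r in (0 : ℝ)..z.2, F (z.1 - A z.2 + A r, r) (α r) := by
    simp only [action, hα.pathTo_eq, hA]
  have h4 : |action F α z.1 z.2 - ∫ r in (0 : ℝ)..z.2, F (γ r, r) (α r)| ≤ ε / 2 := by
    rw [hz, ← intervalIntegral.integral_sub (h.intervalIntegrable_comp hα (by fun_prop) _ _)
      (h.intervalIntegrable_comp hα hγc _ _)]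
    have := intervalIntegral.norm_integral_le_of_norm_le_const (a := 0) (b := z.2)
      (f := fun r => F (z.1 - A z.2 + A r, r) (α r) - F (γ r, r) (α r))
      (C := ε / (2 * (|z₀.2| + 1))) fun r _ => by
        rw [Real.norm_eq_abs]
        refine (hu _ _ _ _ (hR r) (hR r) ?_ (by simpa using hδ)).le
        rw [Prod.dist_eq, max_lt_iff]
        exact ⟨by simpa [hγ] using h2, by simpa using hδ⟩
    rw [Real.norm_eq_abs, sub_zero] at this
    refine this.trans ?_
    calc ε / (2 * (|z₀.2| + 1)) * |z.2| ≤ ε / (2 * (|z₀.2| + 1)) * (|z₀.2| + 1) := by gcongr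
      _ = ε / 2 := by field_simp
  have h5 : |(∫ r in (0 : ℝ)..z.2, F (γ r, r) (α r)) - action F α z₀.1 z₀.2| < ε / 2 := by
    rw [hz0]; exact h1
  rw [Real.dist_eq]
  calc _ ≤ _ := abs_sub_le _ (∫ r in (0 : ℝ)..z.2, F (γ r, r) (α r)) _
    _ < ε := by linarith

/-- An infimum of continuous functions is upper semicontinuous. This half of continuity suffices
because the value enters the doubled functional with a nonpositive factor, and that functional is
minimized. -/
theorem value_upperSemicontinuousOn (h : IsDualPair F G n q N₁ C) (hN : 0 < N₁) :
    UpperSemicontinuousOn (fun z : Space d × ℝ => value F z.1 z.2) (univ ×ˢ Ici 0) := by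
  intro z hz y hy
  have : Nonempty {α : ℝ → Space d // IsStep α} := ⟨⟨_, IsStep.const 0⟩⟩
  obtain ⟨α, hα⟩ := exists_lt_of_ciInf_lt hy
  have := ((h.continuous_action α.2).continuousAt (x := z)).eventually_lt_const hα
  filter_upwards [mem_nhdsWithin_of_mem_nhds this, self_mem_nhdsWithin] with z' h1 h2
  exact (h.value_le_action hN α.2 z'.1 h2.2).trans_lt h1

/-- Any control up to time `s` may be followed by the constant velocity `v`. This half of dynamic
programming replaces a viscosity test of the value function in the doubling argument. -/
theorem value_le_add (h : IsDualPair F G n q N₁ C) (hN : 0 < N₁) (x v : Space d) {s t : ℝ}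
    (hs : 0 ≤ s) (hst : s ≤ t) :
    value F x t ≤ value F (x - (t - s) • v) s + ∫ r in s..t, F (x - (t - r) • v, r) v := by
  have : Nonempty {α : ℝ → Space d // IsStep α} := ⟨⟨_, IsStep.const 0⟩⟩
  rw [← sub_le_iff_le_add]
  refine le_ciInf fun ⟨α, hα⟩ => ?_
  set β : ℝ → Space d := fun r => if r ≤ s then α r else v with hβ
  have hβs : IsStep β := IsStep.ite s hα (IsStep.const v)
  have e1 : ∀ r, s ≤ r → r ≤ t → pathTo β x t r = x - (t - r) • v := fun r hr hrt => by
    have : ∫ τ in r..t, β τ = ∫ _ in r..t, v := by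
      refine intervalIntegral.integral_congr_ae (ae_of_all _ fun τ hτ => ?_)
      rw [uIoc_of_le hrt] at hτ
      simp [hβ, not_le.2 (hr.trans_lt hτ.1)]
    rw [pathTo, this]; simp
  have e2 : ∀ r, r ≤ s → pathTo β x t r = pathTo α (x - (t - s) • v) s r := fun r hr => by
    have h1 : ∫ τ in r..s, β τ = ∫ τ in r..s, α τ := by
      refine intervalIntegral.integral_congr_ae (ae_of_all _ fun τ hτ => ?_)
      rw [uIoc_of_le hr] at hτ
      simp [hβ, hτ.2]
    have h2 := hβs.pathTo_sub x t r s
    rw [e1 s le_rfl hst, sub_eq_iff_eq_add, intervalIntegral.integral_symm, h1] at h2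
    rw [h2, pathTo]; abel
  have e3 := h.value_le_action hN hβs x (hs.trans hst)
  rw [action, ← intervalIntegral.integral_add_adjacent_intervals (b := s)
    (h.intervalIntegrable_comp hβs (hβs.continuous_pathTo x t) _ _)
    (h.intervalIntegrable_comp hβs (hβs.continuous_pathTo x t) _ _)] at e3
  have e4 : ∫ r in (0 : ℝ)..s, F (pathTo β x t r, r) (β r) = action F α (x - (t - s) • v) s := by
    refine intervalIntegral.integral_congr_ae (ae_of_all _ fun τ hτ => ?_)
    rw [uIoc_of_le hs] at hτ
    simp [hβ, hτ.2, ← e2 τ hτ.2]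
  have e5 : ∫ r in s..t, F (pathTo β x t r, r) (β r) = ∫ r in s..t, F (x - (t - r) • v, r) v := by
    refine intervalIntegral.integral_congr_ae (ae_of_all _ fun τ hτ => ?_)
    rw [uIoc_of_le hst] at hτ
    simp only [hβ, not_le.2 hτ.1, if_false]
    rw [← e1 τ hτ.1.le hτ.2]
  rw [e4, e5] at e3
  linarith

end IsDualPair

/-- A bound for the increments of `u` along segments gives one along piecewise affine paths. -/
theorem IsStep.le_add_integral {d : ℕ} {F G : Space d × ℝ → Space d → ℝ} {n : ℝ → ℝ}
    {q N₁ C : ℝ} (h : IsDualPair F G n q N₁ C) {u : Space d → ℝ → ℝ}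
    (hu : ∀ (x v : Space d) (a b : ℝ), 0 ≤ a → a ≤ b →
      u (x + (b - a) • v) b ≤ u x a + ∫ r in a..b, F (x + (r - a) • v, r) v)
    {α : ℝ → Space d} (hα : IsStep α) {γ : ℝ → Space d} (hγ : Continuous γ) {a b : ℝ}
    (ha : 0 ≤ a) (hab : a ≤ b) (hγα : ∀ r ∈ Icc a b, γ r = γ a + ∫ s in a..r, α s) :
    u (γ b) b ≤ u (γ a) a + ∫ r in a..b, F (γ r, r) (α r) := by
  induction hα generalizing a b with
  | const v =>
    have e : ∀ r ∈ Icc a b, γ r = γ a + (r - a) • v := fun r hr => by simpa using hγα r hr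
    have := hu (γ a) v a b ha hab
    rw [← e b ⟨hab, le_rfl⟩] at this
    refine this.trans_eq ?_
    congr 1
    refine intervalIntegral.integral_congr fun r hr => ?_
    rw [uIcc_of_le hab] at hr
    simp only [e r hr]
  -- On either side of `c` the control agrees with `α` or `β`, apart from null sets, so the
  -- induction hypotheses apply; an interval containing `c` is cut there.
  | @ite c α β hα hβ h1 h2 =>
    have hs := IsStep.ite c hα hβ
    have left : ∀ a' b', a ≤ a' → a' ≤ b' → b' ≤ b → b' ≤ c →
        u (γ b') b' ≤ u (γ a') a' +
          ∫ r in a'..b', F (γ r, r) (if r ≤ c then α r else β r) := by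
      intro a' b' haa hab' hbb hbc
      have e : ∀ r ∈ Icc a' b', ∫ s in a'..r, (if s ≤ c then α s else β s) = ∫ s in a'..r, α s := by
        intro r hr
        refine intervalIntegral.integral_congr_ae (ae_of_all _ fun s hs => ?_)
        rw [uIoc_of_le hr.1] at hs
        simp [hs.2.trans (hr.2.trans hbc)]
      have := h1 (ha.trans haa) hab' fun r hr => by
        rw [← e r hr, hγα r ⟨haa.trans hr.1, hr.2.trans hbb⟩, hγα a' ⟨haa, hab'.trans hbb⟩, add_assoc,
          intervalIntegral.integral_add_adjacent_intervals (hs.intervalIntegrable _ _)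
          (hs.intervalIntegrable _ _)]
      refine this.trans_eq ?_
      congr 1
      refine intervalIntegral.integral_congr_ae (ae_of_all _ fun s hs => ?_)
      rw [uIoc_of_le hab'] at hs
      simp [hs.2.trans hbc]
    have right : ∀ a' b', a ≤ a' → a' ≤ b' → b' ≤ b → c ≤ a' →
        u (γ b') b' ≤ u (γ a') a' +
          ∫ r in a'..b', F (γ r, r) (if r ≤ c then α r else β r) := by
      intro a' b' haa hab' hbb hca
      have e : ∀ r ∈ Icc a' b', ∫ s in a'..r, (if s ≤ c then α s else β s) = ∫ s in a'..r, β s := by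
        intro r hr
        refine intervalIntegral.integral_congr_ae (ae_of_all _ fun s hs => ?_)
        rw [uIoc_of_le hr.1] at hs
        simp [not_le.2 (hca.trans_lt hs.1)]
      have := h2 (ha.trans haa) hab' fun r hr => by
        rw [← e r hr, hγα r ⟨haa.trans hr.1, hr.2.trans hbb⟩, hγα a' ⟨haa, hab'.trans hbb⟩, add_assoc,
          intervalIntegral.integral_add_adjacent_intervals (hs.intervalIntegrable _ _)
          (hs.intervalIntegrable _ _)]
      refine this.trans_eq ?_
      congr 1
      refine intervalIntegral.integral_congr_ae (ae_of_all _ fun s hs => ?_)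
      rw [uIoc_of_le hab'] at hs
      simp [not_le.2 (hca.trans_lt hs.1)]
    rcases le_total b c with hbc | hcb
    · exact left a b le_rfl hab le_rfl hbc
    rcases le_total c a with hca | hac
    · exact right a b le_rfl hab le_rfl hca
    have l := left a c le_rfl hac hcb le_rfl
    have r := right c b hac hcb le_rfl le_rfl
    rw [← intervalIntegral.integral_add_adjacent_intervals
      (h.intervalIntegrable_comp hs hγ a c) (h.intervalIntegrable_comp hs hγ c b)]
    linarith

end HJ

/-! ### Subsolutions along paths -/

namespace HJ

open Filter Topology

variable {d : ℕ}

theorem hasGradientAt_mul_norm_sub_sq (a b : ℝ) (c x : Space d) :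
    HasGradientAt (fun y => a * ‖y - c‖ ^ 2 + b) ((2 * a) • (x - c)) x := by
  rw [hasGradientAt_iff_hasFDerivAt]
  have h := (((hasFDerivAt_id x).sub_const c).norm_sq.const_mul a).add_const b
  refine h.congr_fderiv ?_
  ext y
  simp
  ring

theorem hasDerivAt_integral {f : ℝ → ℝ} (hf : Continuous f) (a t : ℝ) :
    HasDerivAt (fun t => ∫ r in a..t, f r) (f t) t :=
  intervalIntegral.integral_hasDerivAt_right (hf.intervalIntegrable _ _)
    (hf.stronglyMeasurableAtFilter _ _) hf.continuousAt

theorem contDiff_integral {f : ℝ → ℝ} (hf : Continuous f) (a : ℝ) :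
    ContDiff ℝ 1 fun t => ∫ r in a..t, f r := by
  rw [contDiff_one_iff_deriv]
  refine ⟨fun t => (hasDerivAt_integral hf a t).differentiableAt, ?_⟩
  rwa [funext fun t => (hasDerivAt_integral hf a t).deriv]

theorem hasDerivAt_mul_exp (η c b t : ℝ) :
    HasDerivAt (fun r => η * Real.exp (c * (r - b))) (η * c * Real.exp (c * (t - b))) t := by
  have := ((((hasDerivAt_id t).sub_const b).const_mul c).exp).const_mul η
  refine this.congr_deriv ?_
  simp only [id_eq, mul_one]
  ring

/-- A viscosity subsolution grows along a segment at most by the action of the segment. -/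
theorem IsViscositySolution.le_add_integral_segment {F G : Space d × ℝ → Space d → ℝ} {n : ℝ → ℝ}
    {q N₁ C : ℝ} {u : Space d → ℝ → ℝ} (hu : IsViscositySolution (fun x t p => G (x, t) p) u)
    (h : IsDualPair F G n q N₁ C) (x v : Space d) (a b : ℝ) (ha : 0 ≤ a) (hab : a ≤ b) :
    u (x + (b - a) • v) b ≤ u x a + ∫ r in a..b, F (x + (r - a) • v, r) v := by
  by_contra! hlt
  set l : ℝ → ℝ := fun r => F (x + (r - a) • v, r) v with hl
  have hlc : Continuous l := h.continuous.comp (by fun_prop : Continuous fun r : ℝ =>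
    ((x + (r - a) • v, r), v))
  -- With a third of the gap, `Φ (x, b) = u x a + 2 g` once the exponential term has taken its share
  -- `g`.
  set g : ℝ := (u (x + (b - a) • v) b - (u x a + ∫ r in a..b, l r)) / 3 with hg
  have hg0 : 0 < g := by rw [hg]; linarith
  obtain ⟨M, hM⟩ := hu.bounded (b + 1)
  obtain ⟨M', hM'⟩ := h.bounded (‖v‖ + 1) (by positivity)
  have hM0 : 0 ≤ M := (abs_nonneg _).trans (hM x a ⟨ha, by linarith⟩)
  have hM0' : 0 ≤ M' := (abs_nonneg _).trans (hM' (x, a) v (by linarith))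
  set B : ℝ := M + M' * (b + 1 - a) with hB
  have hint : ∀ r ∈ Icc a (b + 1), |∫ τ in a..r, l τ| ≤ M' * (b + 1 - a) := by
    intro r hr
    have := intervalIntegral.norm_integral_le_of_norm_le_const (a := a) (b := r) (f := l) (C := M')
      fun τ _ => hM' _ v (by linarith)
    rw [Real.norm_eq_abs, abs_of_nonneg (sub_nonneg.2 hr.1)] at this
    exact this.trans (by gcongr; exact hr.2)
  have hD : ∀ y, ∀ r ∈ Icc a (b + 1), |u y r - ∫ τ in a..r, l τ| ≤ B := fun y r hr =>
    (abs_sub _ _).trans (add_le_add (hM y r ⟨ha.trans hr.1, hr.2⟩) (hint r hr))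
  have hB0 : 0 ≤ B := by
    have : 0 ≤ b + 1 - a := by linarith
    positivity
  -- Since `g * c = 2 B + 1`, the exponential term at time `b + 1` exceeds the oscillation of the
  -- rest and keeps the maximum away from that time. Its derivative supplies the strict margin `c₀`.
  set c : ℝ := (2 * B + 1) / g with hc
  have hc0 : 0 < c := by positivity
  set c₀ : ℝ := g * c * Real.exp (c * (a - b)) with hc₀
  have hc₀0 : 0 < c₀ := by positivity
  obtain ⟨δ, hδ, huc⟩ := h.uniformContinuous (‖v‖ + 1) (by positivity) c₀ hc₀0
  have hcont : ContinuousOn (fun y => u y a) univ :=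
    hu.continuousOn.comp (f := fun y : Space d => (y, a)) (by fun_prop)
      fun y _ => ⟨mem_univ _, ha⟩
  obtain ⟨δ', hδ', huc'⟩ := Metric.continuous_iff.1 (continuousOn_univ.1 hcont) x g hg0
  set ρ : ℝ := min (min δ δ') 1 with hρ
  have hρ0 : 0 < ρ := by positivity
  set N : ℝ := (2 * B + g + 1) / ρ ^ 2 with hN
  have hN0 : 0 < N := by positivity
  -- The space variable moves with the segment, and the quadratic term pins it near `x`. The
  -- interval is prolonged to `b + 1` so that a maximum point at time `b` is interior.
  set Φ : Space d × ℝ → ℝ := fun z => u (z.1 + (z.2 - a) • v) z.2 - (∫ τ in a..z.2, l τ)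
    - g * Real.exp (c * (z.2 - b)) - N * ‖z.1 - x‖ ^ 2 with hΦ
  have hK : IsCompact (Metric.closedBall x 1 ×ˢ Icc a (b + 1)) :=
    (isCompact_closedBall x 1).prod isCompact_Icc
  have hΦc : ContinuousOn Φ (Metric.closedBall x 1 ×ˢ Icc a (b + 1)) := by
    have h1 : ContinuousOn (fun z : Space d × ℝ => u (z.1 + (z.2 - a) • v) z.2)
        (Metric.closedBall x 1 ×ˢ Icc a (b + 1)) :=
      hu.continuousOn.comp (f := fun z : Space d × ℝ => (z.1 + (z.2 - a) • v, z.2)) (by fun_prop)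
        fun z hz => ⟨mem_univ _, ha.trans hz.2.1⟩
    have h2 : Continuous fun z : Space d × ℝ => ∫ τ in a..z.2, l τ :=
      (contDiff_integral hlc a).continuous.comp continuous_snd
    have h3 : ContinuousOn (fun z : Space d × ℝ => g * Real.exp (c * (z.2 - b)))
        (Metric.closedBall x 1 ×ˢ Icc a (b + 1)) := by fun_prop
    have h4 : ContinuousOn (fun z : Space d × ℝ => N * ‖z.1 - x‖ ^ 2)
        (Metric.closedBall x 1 ×ˢ Icc a (b + 1)) := by fun_prop
    exact ((h1.sub h2.continuousOn).sub h3).sub h4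
  obtain ⟨⟨y₀, r₀⟩, hmem, hmax⟩ := hK.exists_isMaxOn ⟨(x, b), by simp [hab]⟩ hΦc
  have hr₀ : r₀ ∈ Icc a (b + 1) := hmem.2
  have hxb : Φ (x, b) ≤ Φ (y₀, r₀) := hmax (⟨by simp, hab, by simp⟩ :
    (x, b) ∈ Metric.closedBall x 1 ×ˢ Icc a (b + 1))
  have hΦxb : Φ (x, b) = u x a + 2 * g := by
    simp only [hΦ, hg]; simp; ring
  have hlow : -B - g ≤ Φ (x, b) := by
    have := (abs_le.1 (hD (x + (b - a) • v) b ⟨hab, by linarith⟩)).1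
    simp only [hΦ]; simp; linarith
  have hup := (abs_le.1 (hD (y₀ + (r₀ - a) • v) r₀ hr₀)).2
  have hexp := Real.exp_pos (c * (r₀ - b))
  have hy₀ : ‖y₀ - x‖ < ρ := by
    have h1 : N * ‖y₀ - x‖ ^ 2 ≤ 2 * B + g := by
      simp only [hΦ] at hxb hlow
      nlinarith [mul_pos hg0 hexp]
    have h2 : N * ‖y₀ - x‖ ^ 2 < N * ρ ^ 2 := by
      have : N * ρ ^ 2 = 2 * B + g + 1 := by rw [hN]; field_simp
      linarith
    exact lt_of_pow_lt_pow_left₀ 2 hρ0.le (lt_of_mul_lt_mul_left h2 hN0.le)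
  have hra : a < r₀ := by
    refine lt_of_le_of_ne hr₀.1 fun heq => ?_
    have h1 := (abs_lt.1 (huc' y₀ (by
      rw [dist_eq_norm]; exact hy₀.trans_le ((min_le_left _ _).trans (min_le_right _ _))))).2
    simp only [← heq] at hxb hexp
    rw [hΦxb] at hxb
    simp only [hΦ] at hxb
    simp at hxb h1
    nlinarith [mul_pos hg0 hexp, mul_nonneg hN0.le (sq_nonneg ‖y₀ - x‖)]
  have hrb : r₀ < b + 1 := by
    refine lt_of_le_of_ne hr₀.2 fun heq => ?_
    simp only [heq] at hxb hup
    have h1 : g * Real.exp (c * (b + 1 - b)) ≥ g + 2 * B + 1 := by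
      have h2 := Real.add_one_le_exp c
      have h3 : g * c = 2 * B + 1 := by rw [hc]; field_simp
      rw [add_sub_cancel_left, mul_one]
      nlinarith
    simp only [hΦ] at hxb hlow
    nlinarith [mul_nonneg hN0.le (sq_nonneg ‖y₀ - x‖)]
  set z₀ : Space d := y₀ + (r₀ - a) • v with hz₀
  set ψ : Space d × ℝ → ℝ := fun z => (∫ τ in a..z.2, l τ) + g * Real.exp (c * (z.2 - b))
    + N * ‖z.1 - x - (z.2 - a) • v‖ ^ 2 with hψ
  have hψ1 : ContDiff ℝ 1 ψ := by
    have h1 : ContDiff ℝ 1 fun z : Space d × ℝ => ∫ τ in a..z.2, l τ :=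
      (contDiff_integral hlc a).comp contDiff_snd
    have h2 : ContDiff ℝ 1 fun z : Space d × ℝ => ‖z.1 - x - (z.2 - a) • v‖ ^ 2 :=
      ContDiff.norm_sq ℝ (by fun_prop)
    fun_prop
  have hloc : IsLocalMax (fun z : Space d × ℝ => u z.1 z.2 - ψ z) (z₀, r₀) := by
    have h1 : ∀ᶠ z : Space d × ℝ in 𝓝 (z₀, r₀), ‖z.1 - (z.2 - a) • v - x‖ < 1 := by
      have : Continuous fun z : Space d × ℝ => ‖z.1 - (z.2 - a) • v - x‖ := by fun_prop
      refine this.continuousAt.eventually_lt_const ?_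
      simp only [hz₀, add_sub_cancel_right]
      exact hy₀.trans_le (min_le_right _ _)
    have h2 : ∀ᶠ z : Space d × ℝ in 𝓝 (z₀, r₀), z.2 ∈ Ioo a (b + 1) :=
      continuous_snd.continuousAt.eventually (Ioo_mem_nhds hra hrb)
    filter_upwards [h1, h2] with z hz1 hz2
    have := hmax (⟨by simpa [dist_eq_norm] using hz1.le, hz2.1.le, hz2.2.le⟩ :
      (z.1 - (z.2 - a) • v, z.2) ∈ Metric.closedBall x 1 ×ˢ Icc a (b + 1))
    simp only [hΦ, mem_ofPred_eq, sub_add_cancel] at this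
    simp only [hψ, hz₀]
    have e1 : z.1 - x - (z.2 - a) • v = z.1 - (z.2 - a) • v - x := by abel
    have e2 : y₀ + (r₀ - a) • v - x - (r₀ - a) • v = y₀ - x := by abel
    rw [e1, e2]
    linarith
  have hsub := hu.subsolution ψ hψ1 z₀ r₀ (ha.trans_lt hra) hloc
  have hgrad : gradient (fun y => ψ (y, r₀)) z₀ = (2 * N) • (y₀ - x) := by
    have h1 := hasGradientAt_mul_norm_sub_sq N
      ((∫ τ in a..r₀, l τ) + g * Real.exp (c * (r₀ - b))) (x + (r₀ - a) • v) z₀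
    have h2 : (fun y => ψ (y, r₀)) = fun y => N * ‖y - (x + (r₀ - a) • v)‖ ^ 2 +
        ((∫ τ in a..r₀, l τ) + g * Real.exp (c * (r₀ - b))) := by
      funext y; simp only [hψ, sub_sub]; ring
    rw [h2, h1.gradient, hz₀]
    congr 1; abel
  have hder : deriv (fun s => ψ (z₀, s)) r₀ =
      l r₀ + g * c * Real.exp (c * (r₀ - b)) - inner ℝ ((2 * N) • (y₀ - x)) v := by
    have h1 : HasDerivAt (fun s : ℝ => z₀ - x - (s - a) • v) (-v) r₀ := by
      simpa using (((hasDerivAt_id r₀).sub_const a).smul_const v).const_sub (z₀ - x)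
    have h2 := h1.norm_sq.const_mul N
    have h3 := ((hasDerivAt_integral hlc a r₀).add (hasDerivAt_mul_exp g c b r₀)).add h2
    refine h3.deriv.trans ?_
    have e2 : z₀ - x - (r₀ - a) • v = y₀ - x := by rw [hz₀]; abel
    rw [e2, inner_neg_right, inner_smul_left]
    simp; ring
  rw [hgrad, hder] at hsub
  -- The transport term `⟪p, v⟫` cancels between the subsolution inequality and `young`. What
  -- remains is `F` at `z₀` against `F` on the segment, closer than the margin `c₀`.
  have hy := h.young (z₀, r₀) ((2 * N) • (y₀ - x)) v
  have hF := (abs_lt.1 (huc (z₀, r₀) (x + (r₀ - a) • v, r₀) v v (by linarith) (by linarith) (by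
    rw [Prod.dist_eq, max_lt_iff]
    refine ⟨?_, by simpa using hδ⟩
    simp only [hz₀, dist_eq_norm, add_sub_add_right_eq_sub]
    exact hy₀.trans_le ((min_le_left _ _).trans (min_le_left _ _))) (by simpa using hδ))).2
  have hχ : c₀ ≤ g * c * Real.exp (c * (r₀ - b)) := by
    rw [hc₀]; gcongr
  simp only [hl] at hsub
  linarith

/-- A viscosity subsolution grows along a piecewise affine path at most by its action. -/
theorem IsViscositySolution.le_add_integral {F G : Space d × ℝ → Space d → ℝ} {n : ℝ → ℝ}
    {q N₁ C : ℝ} {u : Space d → ℝ → ℝ} (hu : IsViscositySolution (fun x t p => G (x, t) p) u)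
    (h : IsDualPair F G n q N₁ C) {α : ℝ → Space d} (hα : IsStep α) (x : Space d) {t a b : ℝ}
    (ha : 0 ≤ a) (hab : a ≤ b) :
    u (pathTo α x t b) b ≤ u (pathTo α x t a) a + ∫ r in a..b, F (pathTo α x t r, r) (α r) := by
  refine hα.le_add_integral h (hu.le_add_integral_segment h) (hα.continuous_pathTo x t) ha hab
    fun r _ => ?_
  rw [← hα.pathTo_sub x t r a]; abel

/-! ### Absorbing an integrable error; doubling of variables -/

/-- A nonnegative integrable function on an interval is dominated, in the limit and locally
uniformly, by continuous functions of almost the same integral. -/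
theorem exists_continuous_approx_above {f : ℝ → ℝ} {T ε : ℝ} (hT : 0 ≤ T) (hf0 : ∀ t, 0 ≤ f t)
    (hf : IntervalIntegrable f volume 0 T) (hε : 0 < ε) :
    ∃ b : ℕ → ℝ → ℝ, (∀ k, Continuous (b k)) ∧ (∀ k t, 0 ≤ b k t) ∧
      (∀ k, ∀ t, 0 ≤ t → ∫ r in (0 : ℝ)..t, b k r ≤ (∫ r in (0 : ℝ)..T, f r) + ε) ∧
      ∀ t ∈ Icc 0 T, ∀ᶠ y : ℕ × ℝ in atTop ×ˢ 𝓝 t, f t ≤ b y.1 y.2 := by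
  have hfi : Integrable (indicator (Icc 0 T) f) := by
    rw [integrable_indicator_iff measurableSet_Icc]
    exact (intervalIntegrable_iff_integrableOn_Icc_of_le hT).1 hf
  have hfi0 : ∀ t, 0 ≤ indicator (Icc 0 T) f t := fun t => indicator_nonneg (fun s _ => hf0 s) t
  have hco : (fun t => ((indicator (Icc 0 T) f t).toNNReal : ℝ)) = indicator (Icc 0 T) f :=
    funext fun t => Real.coe_toNNReal _ (hfi0 t)
  -- Vitali–Carathéodory provides a strict lower semicontinuous majorant with almost the same
  -- integral.
  obtain ⟨g, hfg, hgl, hgt, hgi, hgε⟩ := exists_lt_lowerSemicontinuous_integral_gt_nnreal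
    (μ := (volume : Measure ℝ)) (fun t => (indicator (Icc 0 T) f t).toNNReal)
    (by rw [hco]; exact hfi) hε
  rw [hco, integral_indicator measurableSet_Icc, integral_Icc_eq_integral_Ioc,
    ← intervalIntegral.integral_of_le hT] at hgε
  set gk : ℕ → ℝ → ℝ := fun k s => (min (g s) k).toReal with hgk
  have hgk0 : ∀ k s, 0 ≤ gk k s := fun k s => ENNReal.toReal_nonneg
  -- The inf-convolution of the truncated majorant is `k`-Lipschitz and lies below it. Near `t` it
  -- is at least `f t` for large `k`: nearby `s` have `g s > f t`, and distant ones pay the penalty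
  -- `k * |t - s|`.
  set b : ℕ → ℝ → ℝ := fun k t => ⨅ s : ℝ, (gk k s + k * |t - s|) with hb
  have hbdd : ∀ (k : ℕ) t, BddBelow (range fun s : ℝ => gk k s + k * |t - s|) := fun k t =>
    ⟨0, by rintro _ ⟨s, rfl⟩; have := hgk0 k s; positivity⟩
  have hbk : ∀ k t, b k t ≤ gk k t := fun k t => by
    have := ciInf_le (hbdd k t) t
    simpa using this
  have hb0 : ∀ k t, 0 ≤ b k t := fun k t =>
    le_ciInf fun s => by have := hgk0 k s; positivity
  have hbc : ∀ k, Continuous (b k) := fun k => by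
    refine (LipschitzWith.of_le_add_mul (k : NNReal) fun t t' => ?_).continuous
    rw [← sub_le_iff_le_add]
    refine le_ciInf fun s => ?_
    rw [sub_le_iff_le_add]
    refine (ciInf_le (hbdd k t) s).trans ?_
    have : |t - s| ≤ |t' - s| + dist t t' := by
      rw [Real.dist_eq, add_comm]; exact abs_sub_le _ _ _
    have h2 := mul_le_mul_of_nonneg_left this (Nat.cast_nonneg k : (0 : ℝ) ≤ k)
    simp only [NNReal.coe_natCast]
    linarith
  refine ⟨b, hbc, hb0, fun k t ht => ?_, fun t ht => ?_⟩
  · calc ∫ r in (0 : ℝ)..t, b k r ≤ ∫ r in (0 : ℝ)..t, (g r).toReal := by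
          refine intervalIntegral.integral_mono_ae ht ((hbc k).intervalIntegrable _ _)
            hgi.intervalIntegrable ?_
          filter_upwards [hgt] with r hr
          exact (hbk k r).trans (ENNReal.toReal_mono hr.ne (min_le_left _ _))
      _ ≤ ∫ r, (g r).toReal := by
          rw [intervalIntegral.integral_of_le ht]
          exact setIntegral_le_integral hgi (ae_of_all _ fun r => ENNReal.toReal_nonneg)
      _ ≤ _ := hgε.le
  · have h1 : ENNReal.ofReal (f t) < g t := by
      have := hfg t
      rwa [indicator_of_mem ht] at this
    obtain ⟨δ, hδ, hball⟩ := Metric.eventually_nhds_iff.1 (hgl t _ h1)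
    have hk : ∀ᶠ k : ℕ in atTop, f t ≤ k ∧ f t ≤ k * (δ / 2) :=
      (tendsto_natCast_atTop_atTop.eventually_ge_atTop _).and
        ((tendsto_natCast_atTop_atTop.atTop_mul_const (half_pos hδ)).eventually_ge_atTop _)
    have ht' : ∀ᶠ t' in 𝓝 t, dist t' t < δ / 2 := Metric.ball_mem_nhds t (half_pos hδ)
    filter_upwards [hk.prod_mk ht'] with ⟨k, t'⟩ ⟨⟨hk1, hk2⟩, hd⟩
    dsimp only at hk1 hk2 hd ⊢
    refine le_ciInf fun s => ?_
    by_cases hs : dist s t < δ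
    · have h2 : f t ≤ gk k s := by
        have h3 : ENNReal.ofReal (f t) ≤ min (g s) k := by
          refine le_min (hball hs).le ?_
          rw [← ENNReal.ofReal_natCast]; exact ENNReal.ofReal_le_ofReal hk1
        have h4 : min (g s) (k : ENNReal) ≠ ⊤ := ne_top_of_le_ne_top (by simp) (min_le_right _ _)
        have := ENNReal.toReal_mono h4 h3
        rwa [ENNReal.toReal_ofReal (hf0 t)] at this
      have : (0 : ℝ) ≤ k * |t' - s| := by positivity
      linarith
    · have h2 : δ / 2 ≤ |t' - s| := by
        have := dist_triangle s t' t
        rw [← Real.dist_eq, dist_comm]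
        linarith
      have h3 : (k : ℝ) * (δ / 2) ≤ k * |t' - s| := by gcongr
      have := hgk0 k s
      linarith

/-- The excess of an integrable function over a high level has small integral. -/
theorem exists_integral_excess_lt {n : ℝ → ℝ} {T ε : ℝ} (hn : IntervalIntegrable n volume 0 T)
    (hn0 : ∀ t, 0 ≤ n t) (hε : 0 < ε) :
    ∃ m₀ : ℝ, ∀ m, m₀ ≤ m → ∫ r in (0 : ℝ)..T, max (n r - m) 0 < ε := by
  have : Tendsto (fun m : ℝ => ∫ r in (0 : ℝ)..T, max (n r - m) 0) atTop
      (𝓝 (∫ _ in (0 : ℝ)..T, (0 : ℝ))) := by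
    refine intervalIntegral.tendsto_integral_filter_of_dominated_convergence n ?_ ?_ hn ?_
    · refine Eventually.of_forall fun m => ?_
      have h1 := hn.aestronglyMeasurable_restrict_uIoc
      exact (h1.sub aestronglyMeasurable_const).sup aestronglyMeasurable_const
    · filter_upwards [eventually_ge_atTop 0] with m hm
      refine ae_of_all _ fun r _ => ?_
      rw [Real.norm_of_nonneg (le_max_right _ _)]
      exact max_le (by linarith) (hn0 r)
    · refine ae_of_all _ fun r _ => ?_
      refine tendsto_const_nhds.congr' ?_
      filter_upwards [eventually_ge_atTop (n r)] with m hm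
      rw [max_eq_right (by linarith)]
  rw [intervalIntegral.integral_zero] at this
  obtain ⟨m₀, hm₀⟩ := eventually_atTop.1 (this.eventually_lt_const hε)
  exact ⟨m₀, hm₀⟩

theorem HasDerivAt.nonneg_of_eventually_right {f : ℝ → ℝ} {f' : ℝ} (hf : HasDerivAt f f' 0)
    (h0 : f 0 = 0) (h : ∀ᶠ t in 𝓝[>] 0, 0 ≤ f t) : 0 ≤ f' := by
  have h1 := (hasDerivAt_iff_tendsto_slope.1 hf).mono_left
    (nhdsWithin_mono 0 fun t (ht : t ∈ Ioi (0 : ℝ)) => ht.ne')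
  refine ge_of_tendsto h1 ?_
  filter_upwards [h, self_mem_nhdsWithin] with t ht ht0
  rw [slope_def_field, h0, sub_zero, sub_zero]
  exact div_nonneg ht (le_of_lt ht0)

variable {d : ℕ} {F G : Space d × ℝ → Space d → ℝ} {n : ℝ → ℝ} {q N₁ C : ℝ}

/-- Near a point where the value function exceeds the supersolution `u`, the variables can be
doubled: there are nearby points at which both equations hold with the same momentum, up to the
penalization at infinity, and with the additional error `b`. -/
theorem IsViscositySolution.exists_doubling_point {u : Space d → ℝ → ℝ}
    (hu : IsViscositySolution (fun x t p => G (x, t) p) u) (h : IsDualPair F G n q N₁ C)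
    (hN₁ : 0 < N₁) {x₁ : Space d} {t₁ M M₀ g θ κ Y ρ N c : ℝ} {b : ℝ → ℝ} (ht₁ : 0 < t₁)
    (hM : ∀ x, ∀ t ∈ Icc 0 (t₁ + 1), |u x t| ≤ M)
    (hMw : ∀ x, ∀ t ∈ Icc 0 (t₁ + 1), |value F x t| ≤ M) (hM₀ : ∀ z, F z 0 ≤ M₀) (hM₀0 : 0 ≤ M₀)
    (hg : 0 < g) (hgap : u x₁ t₁ + 6 * g ≤ value F x₁ t₁)
    (hθ0 : 0 ≤ θ) (hθ1 : θ ≤ 1) (hθM : θ * M ≤ g)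
    (hκ : 0 < κ) (hκx : κ * ‖x₁‖ ^ 2 ≤ g) (hxY : ‖x₁‖ ≤ Y)
    (hY : ∀ y : Space d, κ * ‖y‖ ^ 2 ≤ 2 * M → ‖y‖ ≤ Y)
    (hρ : 0 < ρ) (hρ1 : ρ ≤ 1) (hρM : M₀ * ρ ≤ g)
    (hρu : ∀ y : Space d, ‖y‖ ≤ Y → ∀ s, 0 ≤ s → s < ρ → -g ≤ u y s)
    (hN : 2 * M < N * ρ ^ 2) (hc0 : 0 < c) (hc : 2 * M < g * (c + 1))
    (hb : Continuous b) (hb0 : ∀ t, 0 ≤ b t) (hbg : ∀ t, 0 ≤ t → ∫ r in (0 : ℝ)..t, b r ≤ g / 2) :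
    ∃ (x y : Space d) (t s : ℝ), t ∈ Ioc 0 (t₁ + 1) ∧ s ∈ Ioc 0 (t₁ + 1) ∧ ‖x - y‖ ≤ ρ ∧
      |t - s| ≤ ρ ∧ ‖y‖ ≤ Y ∧ κ * ‖y‖ ^ 2 ≤ 2 * M ∧
      (∀ v, b t + inner ℝ ((2 * N) • (x - y)) v + 2 * N * (t - s) ≤ (1 - θ) * F (x, t) v) ∧
      b s + g * c * Real.exp (-(c * t₁)) - 2 * N * (t - s) ≤
        G (y, s) ((2 * N) • (x - y) - (2 * κ) • y) := by
  have hN0 : 0 < N := by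
    have hM' := (abs_nonneg _).trans (hM x₁ t₁ ⟨ht₁.le, by linarith⟩)
    by_contra! hn
    nlinarith [sq_nonneg ρ]
  set B : ℝ → ℝ := fun t => ∫ r in (0 : ℝ)..t, b r with hB
  have hB0 : ∀ t, 0 ≤ t → 0 ≤ B t := fun t ht =>
    intervalIntegral.integral_nonneg ht fun r _ => hb0 r
  -- The factor `1 - θ` leaves a spare `θ F`, coercive in the velocity. The primitives `B`
  -- contribute `b` to both time derivatives, the exponential gives a strict margin, and `κ`
  -- localizes in space.
  set Φ : (Space d × ℝ) × (Space d × ℝ) → ℝ := fun z =>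
    u z.2.1 z.2.2 - (1 - θ) * value F z.1.1 z.1.2 + (N * ‖z.1.1 - z.2.1‖ ^ 2 +
      N * (z.1.2 - z.2.2) ^ 2 + B z.1.2 + B z.2.2 + g * Real.exp (c * (z.2.2 - t₁)) +
      κ * ‖z.2.1‖ ^ 2) with hΦ
  set S : Set (Space d × ℝ) := Metric.closedBall 0 (Y + 2) ×ˢ Icc 0 (t₁ + 1) with hS
  have hK : IsCompact (S ×ˢ S) :=
    ((isCompact_closedBall _ _).prod isCompact_Icc).prod
      ((isCompact_closedBall _ _).prod isCompact_Icc)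
  have hBc : Continuous B := (contDiff_integral hb 0).continuous
  have hΦl : LowerSemicontinuousOn Φ (S ×ˢ S) := by
    have h1 : ContinuousOn (fun z : (Space d × ℝ) × (Space d × ℝ) => u z.2.1 z.2.2) (S ×ˢ S) :=
      hu.continuousOn.comp (f := fun z : (Space d × ℝ) × (Space d × ℝ) => z.2) (by fun_prop)
        fun z hz => ⟨mem_univ _, hz.2.2.1⟩
    have h2 : LowerSemicontinuousOn
        (fun z : (Space d × ℝ) × (Space d × ℝ) => -((1 - θ) * value F z.1.1 z.1.2)) (S ×ˢ S) := by
      have h3 : UpperSemicontinuousOn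
          (fun z : (Space d × ℝ) × (Space d × ℝ) => value F z.1.1 z.1.2) (S ×ˢ S) :=
        (h.value_upperSemicontinuousOn hN₁).comp (g := Prod.fst)
          continuousOn_fst fun z hz => ⟨mem_univ _, hz.1.2.1⟩
      refine Continuous.comp_upperSemicontinuousOn_antitone (g := fun w : ℝ => -((1 - θ) * w))
        (by fun_prop) h3 fun a b hab => ?_
      exact neg_le_neg (mul_le_mul_of_nonneg_left hab (by linarith))
    have h4 : Continuous fun z : (Space d × ℝ) × (Space d × ℝ) => (N * ‖z.1.1 - z.2.1‖ ^ 2 +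
      N * (z.1.2 - z.2.2) ^ 2 + B z.1.2 + B z.2.2 + g * Real.exp (c * (z.2.2 - t₁)) +
      κ * ‖z.2.1‖ ^ 2) := by fun_prop
    have h5 := (h1.lowerSemicontinuousOn.add h2).add h4.continuousOn.lowerSemicontinuousOn
    simpa only [hΦ, sub_eq_add_neg] using h5
  have hbase : ((x₁, t₁), (x₁, t₁)) ∈ S ×ˢ S := by
    have : (x₁, t₁) ∈ S := ⟨by simp; linarith, ht₁.le, by linarith⟩
    exact ⟨this, this⟩
  obtain ⟨⟨⟨x, t⟩, ⟨y, s⟩⟩, hmem, hmin⟩ := hΦl.exists_isMinOn ⟨_, hbase⟩ hK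
  have ht : t ∈ Icc 0 (t₁ + 1) := hmem.1.2
  have hs : s ∈ Icc 0 (t₁ + 1) := hmem.2.2
  have hΦ1 : Φ ((x, t), (y, s)) ≤ -2 * g := by
    refine (hmin hbase).trans ?_
    -- Of the gap `6 g`, the terms in `θ`, the two copies of `B` together, the exponential and the
    -- `κ` penalty use at most `g` each, leaving `-2 g`.
    simp only [hΦ, sub_self, norm_zero, mul_zero, Real.exp_zero]
    have h1 := hbg t₁ ht₁.le
    have h2 := (abs_le.1 (hMw x₁ t₁ ⟨ht₁.le, by linarith⟩)).2
    have h3 := mul_le_mul_of_nonneg_left h2 hθ0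
    simp only [hB]
    linarith
  have hM' := (abs_nonneg _).trans (hM x₁ t₁ ⟨ht₁.le, by linarith⟩)
  have hw1 : (1 - θ) * value F x t ≤ M := by
    have h1 := (abs_le.1 (hMw x t ht)).2
    nlinarith [mul_nonneg (sub_nonneg.2 hθ1) (sub_nonneg.2 h1)]
  have hu1 := (abs_le.1 (hM y s hs)).1
  have p1 : 0 ≤ N * ‖x - y‖ ^ 2 := by positivity
  have p2 : 0 ≤ N * (t - s) ^ 2 := by positivity
  have p3 := hB0 t ht.1
  have p4 := hB0 s hs.1
  have p5 : 0 < g * Real.exp (c * (s - t₁)) := by positivity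
  have p6 : 0 ≤ κ * ‖y‖ ^ 2 := by positivity
  simp only [hΦ] at hΦ1
  have hκy : κ * ‖y‖ ^ 2 ≤ 2 * M := by linarith
  have hyY := hY y hκy
  have hxy : ‖x - y‖ < ρ := by
    have : N * ‖x - y‖ ^ 2 < N * ρ ^ 2 := by linarith
    exact lt_of_pow_lt_pow_left₀ 2 hρ.le (lt_of_mul_lt_mul_left this hN0.le)
  have hts : |t - s| < ρ := by
    have : N * |t - s| ^ 2 < N * ρ ^ 2 := by rw [sq_abs]; linarith
    exact lt_of_pow_lt_pow_left₀ 2 hρ.le (lt_of_mul_lt_mul_left this hN0.le)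
  have hxY' : ‖x‖ ≤ Y + 1 := by
    have : ‖x‖ ≤ ‖x - y‖ + ‖y‖ := by simpa using norm_add_le (x - y) y
    linarith
  have hs1 : s < t₁ + 1 := by
    refine lt_of_le_of_ne hs.2 fun heq => ?_
    have h1 := Real.add_one_le_exp c
    rw [heq, add_sub_cancel_left, mul_one] at p5 hΦ1
    have h2 := mul_le_mul_of_nonneg_left h1 hg.le
    rw [heq] at p4
    rw [heq] at p2
    linarith [heq ▸ hu1]
  -- If one time vanishes, the other is below `ρ`. Then `u` and the value differ too little from
  -- their initial behaviour for `Φ ≤ -2 g`.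
  have hs0 : 0 < s := by
    refine lt_of_le_of_ne hs.1 fun heq => ?_
    have h1 := h.value_le_mul hN₁ hM₀ x ht.1
    rw [← heq, sub_zero, abs_of_nonneg ht.1] at hts
    have h2 : u y s = 0 := by rw [← heq]; exact hu.initial y
    have h3 : M₀ * t ≤ g := (mul_le_mul_of_nonneg_left hts.le hM₀0).trans hρM
    have h4 : (1 - θ) * value F x t ≤ g := by
      have h6 : (1 - θ) * value F x t ≤ (1 - θ) * g :=
        mul_le_mul_of_nonneg_left (h1.trans h3) (by linarith)
      have := mul_nonneg hθ0 hg.le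
      linarith
    linarith
  have ht0 : 0 < t := by
    refine lt_of_le_of_ne ht.1 fun heq => ?_
    have h1 := h.value_le_mul hN₁ hM₀ x ht.1
    rw [← heq, mul_zero] at h1
    have h2 := hρu y hyY s hs.1 (by rw [← heq, zero_sub, abs_neg, abs_of_pos hs0] at hts; exact hts)
    have h3 : (1 - θ) * value F x t ≤ 0 := by
      rw [← heq]; exact mul_nonpos_of_nonneg_of_nonpos (by linarith) h1
    linarith
  refine ⟨x, y, t, s, ⟨ht0, ht.2⟩, ⟨hs0, hs.2⟩, hxy.le, hts.le, hyY, hκy, fun v => ?_, ?_⟩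
  -- Compare the minimum with the point reached by going back for time `τ` at velocity `v`; the
  -- right derivative at `τ = 0` is the inequality. Only earlier times occur, so `t = t₁ + 1` is
  -- allowed.
  · set l : ℝ → ℝ := fun r => F (x - (t - r) • v, r) v with hl
    have hlc : Continuous l := h.continuous.comp (by fun_prop : Continuous fun r : ℝ =>
      ((x - (t - r) • v, r), v))
    set f : ℝ → ℝ := fun τ => (1 - θ) * ((∫ r in (0 : ℝ)..t, l r) - ∫ r in (0 : ℝ)..(t - τ), l r) +
      (N * ‖x - y - τ • v‖ ^ 2 + N * (t - τ - s) ^ 2 + B (t - τ)) -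
      (N * ‖x - y‖ ^ 2 + N * (t - s) ^ 2 + B t) with hf
    have hsub : HasDerivAt (fun τ : ℝ => t - τ) (-1) 0 := by
      simpa using (hasDerivAt_id (0 : ℝ)).const_sub t
    have d1 : HasDerivAt (fun τ => ∫ r in (0 : ℝ)..(t - τ), l r) (l t * -1) 0 := by
      have := hasDerivAt_integral hlc 0 (t - 0)
      have h2 := HasDerivAt.comp 0 this hsub
      rwa [sub_zero] at h2
    have d2 : HasDerivAt (fun τ => B (t - τ)) (b t * -1) 0 := by
      have := hasDerivAt_integral hb 0 (t - 0)
      have h2 := HasDerivAt.comp 0 this hsub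
      rwa [sub_zero] at h2
    have d3 : HasDerivAt (fun τ : ℝ => N * ‖x - y - τ • v‖ ^ 2) (N * (2 * inner ℝ (x - y) (-v))) 0 := by
      have h1 : HasDerivAt (fun τ : ℝ => x - y - τ • v) (-v) 0 := by
        simpa using ((hasDerivAt_id (0 : ℝ)).smul_const v).const_sub (x - y)
      have := h1.norm_sq.const_mul N
      simpa using this
    have d4 : HasDerivAt (fun τ : ℝ => N * (t - τ - s) ^ 2) (N * (2 * (t - s) * -1)) 0 := by
      have := ((hsub.sub_const s).pow 2).const_mul N
      simpa using this
    have hfd : HasDerivAt f ((1 - θ) * (0 - l t * -1) +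
        (N * (2 * inner ℝ (x - y) (-v)) + N * (2 * (t - s) * -1) + b t * -1)) 0 :=
      ((((hasDerivAt_const 0 (∫ r in (0 : ℝ)..t, l r)).sub d1).const_mul (1 - θ)).add
        ((d3.add d4).add d2)).sub_const _
    have hnn := HasDerivAt.nonneg_of_eventually_right hfd (by simp [hf]) (by
      have e1 : ∀ᶠ τ in 𝓝[>] (0 : ℝ), τ < t :=
        mem_nhdsWithin_of_mem_nhds (Iio_mem_nhds ht0)
      have e2 : ∀ᶠ τ in 𝓝[>] (0 : ℝ), ‖x - τ • v‖ < Y + 2 := by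
        refine mem_nhdsWithin_of_mem_nhds ?_
        have hc : Continuous fun τ : ℝ => ‖x - τ • v‖ := by fun_prop
        refine hc.continuousAt.eventually_lt_const ?_
        simp; linarith
      filter_upwards [e1, e2, self_mem_nhdsWithin] with τ h1 h2 h3
      have h3' : 0 < τ := h3
      have hm := hmin (⟨⟨by simpa using h2.le, by simp only; linarith,
        by simp only; linarith [ht.2]⟩, hmem.2⟩ : ((x - τ • v, t - τ), (y, s)) ∈ S ×ˢ S)
      have hv := h.value_le_add hN₁ x v (s := t - τ) (t := t) (by linarith) (by linarith)
      rw [sub_sub_cancel, ← intervalIntegral.integral_interval_sub_left (a := 0)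
        (hlc.intervalIntegrable _ _) (hlc.intervalIntegrable _ _)] at hv
      have hv' := mul_le_mul_of_nonneg_left hv (sub_nonneg.2 hθ1)
      simp only [hΦ, mem_ofPred_eq] at hm
      rw [sub_right_comm x] at hm
      simp only [hf]
      linarith)
    rw [inner_neg_right] at hnn
    rw [inner_smul_left]
    have e : l t = F (x, t) v := by simp [hl]
    rw [e] at hnn
    simp only [RCLike.conj_to_real]
    linarith
  · set ψ : Space d × ℝ → ℝ := fun z => (-N) * ‖z.1 - x‖ ^ 2 + (-κ) * ‖z.1 - 0‖ ^ 2 +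
      (-(N * (t - z.2) ^ 2) - B z.2 - g * Real.exp (c * (z.2 - t₁))) with hψ
    have hψ1 : ContDiff ℝ 1 ψ := by
      have h1 : ContDiff ℝ 1 fun z : Space d × ℝ => B z.2 :=
        (contDiff_integral hb 0).comp contDiff_snd
      have h2 : ContDiff ℝ 1 fun z : Space d × ℝ => ‖z.1 - x‖ ^ 2 :=
        ContDiff.norm_sq ℝ (by fun_prop)
      have h3 : ContDiff ℝ 1 fun z : Space d × ℝ => ‖z.1 - 0‖ ^ 2 :=
        ContDiff.norm_sq ℝ (by fun_prop)
      have h4 : ContDiff ℝ 1 fun z : Space d × ℝ => -(N * (t - z.2) ^ 2) := by fun_prop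
      have h5 : ContDiff ℝ 1 fun z : Space d × ℝ => g * Real.exp (c * (z.2 - t₁)) := by fun_prop
      exact ((contDiff_const.mul h2).add (contDiff_const.mul h3)).add ((h4.sub h1).sub h5)
    have hloc : IsLocalMin (fun z : Space d × ℝ => u z.1 z.2 - ψ z) (y, s) := by
      have h1 : ∀ᶠ z : Space d × ℝ in 𝓝 (y, s), ‖z.1‖ < Y + 2 := by
        have : Continuous fun z : Space d × ℝ => ‖z.1‖ := by fun_prop
        exact this.continuousAt.eventually_lt_const (by dsimp only; linarith)
      have h2 : ∀ᶠ z : Space d × ℝ in 𝓝 (y, s), z.2 ∈ Ioo 0 (t₁ + 1) :=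
        continuous_snd.continuousAt.eventually (Ioo_mem_nhds hs0 hs1)
      filter_upwards [h1, h2] with z hz1 hz2
      have hm := hmin (⟨hmem.1, by simpa using hz1.le, hz2.1.le, hz2.2.le⟩ :
        ((x, t), z) ∈ S ×ˢ S)
      simp only [hΦ, mem_ofPred_eq] at hm
      simp only [hψ, sub_zero]
      rw [norm_sub_rev z.1 x, norm_sub_rev y x]
      linarith
    have hsup := hu.supersolution ψ hψ1 y s hs0 hloc
    have hgrad : gradient (fun y => ψ (y, s)) y = (2 * N) • (x - y) - (2 * κ) • y := by
      have e1 := hasGradientAt_mul_norm_sub_sq (-N) 0 x y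
      have e2 := hasGradientAt_mul_norm_sub_sq (-κ)
        (-(N * (t - s) ^ 2) - B s - g * Real.exp (c * (s - t₁))) 0 y
      have e3 : HasGradientAt (fun y => ψ (y, s)) ((2 * -N) • (y - x) + (2 * -κ) • (y - 0)) y := by
        rw [hasGradientAt_iff_hasFDerivAt] at e1 e2 ⊢
        rw [map_add]
        refine (e1.add e2).congr_of_eventuallyEq (Eventually.of_forall fun z => ?_)
        simp [hψ]
        ring
      rw [e3.gradient, sub_zero]
      module
    have hder : deriv (fun r => ψ (y, r)) s =
        2 * N * (t - s) - b s - g * c * Real.exp (c * (s - t₁)) := by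
      have d1 : HasDerivAt (fun r : ℝ => N * (t - r) ^ 2) (N * (2 * (t - s) * -1)) s := by
        have := ((((hasDerivAt_id s).const_sub t).pow 2).const_mul N)
        simpa using this
      have d2 := ((d1.neg.sub (hasDerivAt_integral hb 0 s)).sub
        (hasDerivAt_mul_exp g c t₁ s)).const_add ((-N) * ‖y - x‖ ^ 2 + (-κ) * ‖y - 0‖ ^ 2)
      refine (d2.deriv).trans ?_
      ring
    rw [hgrad, hder] at hsup
    have hexp : g * c * Real.exp (-(c * t₁)) ≤ g * c * Real.exp (c * (s - t₁)) := by
      gcongr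
      nlinarith
    linarith

end HJ

/-! ### The comparison principle -/

namespace HJ

open Filter Topology

variable {d : ℕ} {F G : Space d × ℝ → Space d → ℝ} {n : ℝ → ℝ} {q N₁ C : ℝ}

/-- With the velocity penalization `θ F`, the Lagrangian at one point is dominated by its value
at a nearby point, up to an error that exceeds `θ n` only where `n` is large. -/
theorem IsDualPair.sub_penalized_lt (h : IsDualPair F G n q N₁ C) (hN₁ : 0 < N₁) (hq : 1 < q)
    {θ R k c₀ : ℝ} (hθ : 0 < θ) (hR : 1 ≤ R) (hc₀ : 0 < c₀) (hk : 0 ≤ k) (hkR : k * R ≤ c₀ / 4)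
    (hkθ : k ≤ θ / (2 * N₁)) {x y v : Space d} {t s : ℝ}
    (huc : ‖v‖ ≤ R → F (x, t) v - F (y, s) v < c₀ / 4) :
    F (x, t) v - F (y, s) v - θ * F (x, t) v + k * ‖v‖ <
      θ * n t + max (n t - θ / (4 * N₁) * R ^ q) 0 +
        (θ * n s + max (n s - θ / (4 * N₁) * R ^ q) 0) + c₀ / 2 := by
  have hlow := mul_le_mul_of_nonneg_left (h.lower (x, t) v) hθ.le
  have hpos : 0 ≤ θ * (1 / N₁ * ‖v‖ ^ q) := by positivity
  have hmt := le_max_right (n t - θ / (4 * N₁) * R ^ q) 0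
  have hmt' := le_max_left (n t - θ / (4 * N₁) * R ^ q) 0
  have hms := le_max_right (n s - θ / (4 * N₁) * R ^ q) 0
  have hms' := le_max_left (n s - θ / (4 * N₁) * R ^ q) 0
  have hns := mul_nonneg hθ.le (h.nonneg s)
  rw [mul_sub] at hlow
  rcases le_or_gt ‖v‖ R with hvR | hvR
  · have h1 := huc hvR
    have h2 : k * ‖v‖ ≤ c₀ / 4 := (mul_le_mul_of_nonneg_left hvR hk).trans hkR
    linarith
  -- For large speeds half of the coercive term `θ / N₁ * ‖v‖ ^ q` pays for `k * ‖v‖`. The other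
  -- half is at least twice the truncation level, once for each of `n t` and `n s`.
  · have h1 := (abs_le.1 (h.regularity (x, t) (y, s) v v)).2
    simp only [sub_self, norm_zero, mul_zero, zero_mul, zero_add] at h1
    have h2 : ‖v‖ ≤ ‖v‖ ^ q := Real.self_le_rpow_of_one_le (by linarith) hq.le
    have h3 : k * ‖v‖ ≤ θ / (2 * N₁) * ‖v‖ ^ q := by gcongr
    have h4 : R ^ q ≤ ‖v‖ ^ q := Real.rpow_le_rpow (by linarith) hvR.le (by linarith)
    have h5 : θ / (2 * N₁) * R ^ q ≤ θ / (2 * N₁) * ‖v‖ ^ q := by gcongr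
    have h6 : θ / (2 * N₁) * R ^ q = 2 * (θ / (4 * N₁) * R ^ q) := by field_simp; ring
    have h7 : θ * (1 / N₁ * ‖v‖ ^ q) = 2 * (θ / (2 * N₁) * ‖v‖ ^ q) := by field_simp
    linarith

set_option maxHeartbeats 1000000 in
/-- The comparison principle: a viscosity supersolution lies above the value function. -/
theorem IsViscositySolution.value_le {u : Space d → ℝ → ℝ}
    (hu : IsViscositySolution (fun x t p => G (x, t) p) u) (h : IsDualPair F G n q N₁ C)
    (hN₁ : 0 < N₁) (hq : 1 < q) (x₁ : Space d) {t₁ : ℝ} (ht₁ : 0 < t₁) :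
    value F x₁ t₁ ≤ u x₁ t₁ := by
  by_contra! hlt
  obtain ⟨g, hg, hgap⟩ : ∃ g, 0 < g ∧ u x₁ t₁ + 6 * g ≤ value F x₁ t₁ :=
    ⟨(value F x₁ t₁ - u x₁ t₁) / 6, by linarith, by linarith⟩
  obtain ⟨M', hM'⟩ := hu.bounded (t₁ + 1)
  obtain ⟨M₀, hM₀'⟩ := h.bounded 1 one_pos
  have hM₀ : ∀ z, F z 0 ≤ M₀ := fun z => (le_abs_self _).trans (hM₀' z 0 (by simp))
  have hM₀0 : 0 ≤ M₀ := (abs_nonneg _).trans (hM₀' (0, 0) 0 (by simp))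
  have hT : (0 : ℝ) ≤ t₁ + 1 := by linarith
  set In : ℝ := ∫ r in (0 : ℝ)..(t₁ + 1), n r with hIn
  have hIn0 : 0 ≤ In := intervalIntegral.integral_nonneg hT fun r _ => h.nonneg r
  have hM'0 : 0 ≤ M' := (abs_nonneg _).trans (hM' x₁ t₁ ⟨ht₁.le, by linarith⟩)
  set M : ℝ := M' + In + M₀ * (t₁ + 1) with hMdef
  have hMT0 : 0 ≤ M₀ * (t₁ + 1) := by positivity
  have hM0 : 0 ≤ M := by positivity
  have hM : ∀ x, ∀ t ∈ Icc 0 (t₁ + 1), |u x t| ≤ M := fun x t ht =>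
    (hM' x t ht).trans (by linarith)
  have hMw : ∀ x, ∀ t ∈ Icc 0 (t₁ + 1), |value F x t| ≤ M := fun x t ht => by
    rw [abs_le]
    have h1 := h.neg_integral_le_value hN₁ x ht.1
    have h2 := h.value_le_mul hN₁ hM₀ x ht.1
    have h3 : ∫ r in (0 : ℝ)..t, n r ≤ In :=
      intervalIntegral.integral_mono_interval le_rfl ht.1 ht.2
        (ae_of_all _ fun r => h.nonneg r) (h.intervalIntegrable _ _)
    have h4 : M₀ * t ≤ M₀ * (t₁ + 1) := mul_le_mul_of_nonneg_left ht.2 hM₀0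
    constructor <;> linarith
  obtain ⟨c, hc0, hc⟩ : ∃ c, 0 < c ∧ 2 * M < g * (c + 1) :=
    ⟨2 * M / g + 1, by positivity, by
      have : g * (2 * M / g + 1 + 1) = 2 * M + 2 * g := by field_simp; ring
      linarith⟩
  set c₀ : ℝ := g * c * Real.exp (-(c * t₁)) with hc₀
  have hc₀0 : 0 < c₀ := by positivity
  obtain ⟨θ, hθ0, hθ1, hθM, hθI⟩ : ∃ θ : ℝ, 0 < θ ∧ θ ≤ 1 ∧ θ * M ≤ g ∧ θ * In ≤ g / 8 := by
    have h1 : 0 < M + 8 * In + g := by positivity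
    have h2 : g / (M + 8 * In + g) * (M + 8 * In + g) = g := by field_simp
    have h3 : 0 < g / (M + 8 * In + g) := by positivity
    refine ⟨g / (M + 8 * In + g), h3, ?_, ?_, ?_⟩
    · rw [div_le_one h1]; linarith
    · nlinarith
    · nlinarith
  obtain ⟨m, hm⟩ := exists_integral_excess_lt (h.intervalIntegrable 0 (t₁ + 1)) h.nonneg
    (show 0 < g / 8 by positivity)
  obtain ⟨R, hR1, hRm⟩ : ∃ R : ℝ, 1 ≤ R ∧ m ≤ θ / (4 * N₁) * R ^ q := by
    have h1 : Tendsto (fun R : ℝ => θ / (4 * N₁) * R ^ q) atTop atTop :=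
      (tendsto_rpow_atTop (by linarith)).const_mul_atTop (by positivity)
    obtain ⟨R, h2, h3⟩ := ((eventually_ge_atTop (1 : ℝ)).and (h1.eventually_ge_atTop m)).exists
    exact ⟨R, h2, h3⟩
  set m' : ℝ := θ / (4 * N₁) * R ^ q with hm'
  -- This is the error in `sub_penalized_lt`. Its integral is below `g / 4`: a small `θ` handles the
  -- first term and a high level `m'` the second.
  set β : ℝ → ℝ := fun r => θ * n r + max (n r - m') 0 with hβ
  have hβ0 : ∀ r, 0 ≤ β r := fun r =>
    add_nonneg (mul_nonneg hθ0.le (h.nonneg r)) (le_max_right _ _)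
  have hi1 : IntervalIntegrable (fun r => θ * n r) volume 0 (t₁ + 1) :=
    (h.intervalIntegrable _ _).const_mul θ
  have hi2 : IntervalIntegrable (fun r => max (n r - m') 0) volume 0 (t₁ + 1) :=
    have h1 : IntervalIntegrable (fun r => n r - m') volume 0 (t₁ + 1) :=
      (h.intervalIntegrable _ _).sub intervalIntegrable_const
    ⟨h1.1.sup (integrable_zero _ _ _), h1.2.sup (integrable_zero _ _ _)⟩
  -- The primitive of `β` need not be `C¹`, so it cannot serve in a test function. Continuous
  -- approximations are used instead, with `k → ∞` after doubling.
  obtain ⟨b, hbc, hb0, hbI, hbβ⟩ := exists_continuous_approx_above hT hβ0 (hi1.add hi2)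
    (show 0 < g / 4 by positivity)
  have hbg : ∀ k t, 0 ≤ t → ∫ r in (0 : ℝ)..t, b k r ≤ g / 2 := fun k t ht => by
    refine (hbI k t ht).trans ?_
    have h1 : ∫ r in (0 : ℝ)..(t₁ + 1), β r = θ * In +
        ∫ r in (0 : ℝ)..(t₁ + 1), max (n r - m') 0 := by
      rw [hIn, ← intervalIntegral.integral_const_mul, ← intervalIntegral.integral_add hi1 hi2]
    have h2 := hm m' hRm
    rw [h1]; linarith
  have hR0 : 0 < R := by linarith
  obtain ⟨k₁, hk₁0, hk₁R, hk₁θ⟩ : ∃ k₁ : ℝ, 0 < k₁ ∧ k₁ * R ≤ c₀ / 4 ∧ k₁ ≤ θ / (2 * N₁) :=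
    ⟨min (c₀ / (4 * R)) (θ / (2 * N₁)), by positivity, by
      calc min (c₀ / (4 * R)) (θ / (2 * N₁)) * R ≤ c₀ / (4 * R) * R := by
            gcongr; exact min_le_left _ _
        _ = c₀ / 4 := by field_simp, min_le_right _ _⟩
  -- At the doubling points `κ * ‖y‖ ^ 2 ≤ 2 * M`, so the last condition bounds the gradient `2 * κ
  -- * ‖y‖` of the penalty by `k₁`.
  obtain ⟨κ, hκ, hκx, hκk⟩ : ∃ κ : ℝ, 0 < κ ∧ κ * ‖x₁‖ ^ 2 ≤ g ∧ 8 * M * κ ≤ k₁ ^ 2 := by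
    refine ⟨min (g / (‖x₁‖ ^ 2 + 1)) (k₁ ^ 2 / (8 * M + 1)), by positivity, ?_, ?_⟩
    · calc _ ≤ g / (‖x₁‖ ^ 2 + 1) * (‖x₁‖ ^ 2 + 1) := by
            gcongr
            · exact min_le_left _ _
            · linarith
        _ = g := by field_simp
    · calc _ ≤ (8 * M + 1) * (k₁ ^ 2 / (8 * M + 1)) := by
            gcongr
            · linarith
            · exact min_le_right _ _
        _ = k₁ ^ 2 := by field_simp
  set Y : ℝ := Real.sqrt (2 * M / κ) + ‖x₁‖ with hYdef
  have hY0 : 0 ≤ Y := by positivity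
  have hY : ∀ y : Space d, κ * ‖y‖ ^ 2 ≤ 2 * M → ‖y‖ ≤ Y := fun y hy => by
    have : ‖y‖ ≤ Real.sqrt (2 * M / κ) := by
      refine Real.le_sqrt_of_sq_le ?_
      rw [le_div_iff₀ hκ]; linarith
    have := norm_nonneg x₁
    linarith
  obtain ⟨δ, hδ, huc⟩ := h.uniformContinuous (R + 1) (by linarith) (c₀ / 4) (by positivity)
  obtain ⟨δ', hδ', huY⟩ : ∃ δ' : ℝ, 0 < δ' ∧
      ∀ y : Space d, ‖y‖ ≤ Y → ∀ s, 0 ≤ s → s < δ' → -g ≤ u y s := by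
    have hKc : IsCompact (Metric.closedBall (0 : Space d) Y ×ˢ Icc (0 : ℝ) 1) :=
      (isCompact_closedBall _ _).prod isCompact_Icc
    have := hKc.uniformContinuousOn_of_continuous
      (hu.continuousOn.mono fun z hz => ⟨mem_univ _, hz.2.1⟩)
    obtain ⟨δ', hδ', H⟩ := Metric.uniformContinuousOn_iff.1 this g hg
    refine ⟨min δ' 1, by positivity, fun y hy s hs0 hs => ?_⟩
    rw [lt_min_iff] at hs
    have h1 := H (y, s) ⟨by simpa using hy, hs0, hs.2.le⟩ (y, 0) ⟨by simpa using hy, by simp⟩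
      (by simpa [Prod.dist_eq, abs_of_nonneg hs0] using ⟨hδ', hs.1⟩)
    simp only [hu.initial, Real.dist_eq, sub_zero] at h1
    exact (abs_lt.1 h1).1.le
  set ρ : ℝ := min (min (δ / 2) δ') (min 1 (g / (M₀ + 1))) with hρdef
  have hρ : 0 < ρ := by positivity
  have hρδ : ρ < δ := lt_of_le_of_lt ((min_le_left _ _).trans (min_le_left _ _)) (by linarith)
  have hρδ' : ρ ≤ δ' := (min_le_left _ _).trans (min_le_right _ _)
  have hρ1 : ρ ≤ 1 := (min_le_right _ _).trans (min_le_left _ _)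
  have hρM : M₀ * ρ ≤ g := by
    calc M₀ * ρ ≤ (M₀ + 1) * (g / (M₀ + 1)) := by
          gcongr
          · linarith
          · exact (min_le_right _ _).trans (min_le_right _ _)
      _ = g := by field_simp
  obtain ⟨N, hN⟩ : ∃ N : ℝ, 2 * M < N * ρ ^ 2 :=
    ⟨(2 * M + 1) / ρ ^ 2, by rw [div_mul_cancel₀ _ (by positivity)]; linarith⟩
  choose xs ys ts ss ht hs hxy hts hyY hκy hsub hsup using fun k =>
    hu.exists_doubling_point h hN₁ ht₁ hM hMw hM₀ hM₀0 hg hgap hθ0.le hθ1 hθM hκ hκx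
      (by rw [hYdef]; have := Real.sqrt_nonneg (2 * M / κ); linarith) hY hρ hρ1 hρM
      (fun y hy s h0 h1 => huY y hy s h0 (h1.trans_le hρδ')) hN hc0 hc (hbc k) (hb0 k) (hbg k)
  set S : Set (Space d × ℝ) := Metric.closedBall 0 (Y + 1) ×ˢ Icc 0 (t₁ + 1) with hSdef
  have hSc : IsCompact (S ×ˢ S) :=
    ((isCompact_closedBall _ _).prod isCompact_Icc).prod
      ((isCompact_closedBall _ _).prod isCompact_Icc)
  obtain ⟨⟨⟨x, t⟩, ⟨y, s⟩⟩, hmem, φ, hφ, hlim⟩ := hSc.tendsto_subseq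
    (x := fun k => ((xs k, ts k), (ys k, ss k))) fun k => by
      have h1 : ‖xs k‖ ≤ ‖xs k - ys k‖ + ‖ys k‖ := by simpa using norm_add_le (xs k - ys k) (ys k)
      have h2 := hxy k
      have h3 := hyY k
      exact ⟨⟨by simp; linarith, (ht k).1.le, (ht k).2⟩, ⟨by simp; linarith, (hs k).1.le, (hs k).2⟩⟩
  have hlx : Tendsto (fun k => xs (φ k)) atTop (𝓝 x) :=
    ((continuous_fst.comp continuous_fst).tendsto _).comp hlim
  have hlt : Tendsto (fun k => ts (φ k)) atTop (𝓝 t) :=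
    ((continuous_snd.comp continuous_fst).tendsto _).comp hlim
  have hly : Tendsto (fun k => ys (φ k)) atTop (𝓝 y) :=
    ((continuous_fst.comp continuous_snd).tendsto _).comp hlim
  have hls : Tendsto (fun k => ss (φ k)) atTop (𝓝 s) :=
    ((continuous_snd.comp continuous_snd).tendsto _).comp hlim
  have hxyl : ‖x - y‖ ≤ ρ := le_of_tendsto (hlx.sub hly).norm (Eventually.of_forall fun k => hxy _)
  have htsl : |t - s| ≤ ρ := le_of_tendsto (hlt.sub hls).abs (Eventually.of_forall fun k => hts _)
  have hκyl : κ * ‖y‖ ^ 2 ≤ 2 * M :=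
    le_of_tendsto ((hly.norm.pow 2).const_mul κ) (Eventually.of_forall fun k => hκy _)
  have hbt : ∀ᶠ k in atTop, β t ≤ b (φ k) (ts (φ k)) :=
    (hφ.tendsto_atTop.prodMk hlt).eventually (hbβ t hmem.1.2)
  have hbs : ∀ᶠ k in atTop, β s ≤ b (φ k) (ss (φ k)) :=
    (hφ.tendsto_atTop.prodMk hls).eventually (hbβ s hmem.2.2)
  set p : Space d := (2 * N) • (x - y) with hp
  have hlp : Tendsto (fun k => (2 * N) • (xs (φ k) - ys (φ k))) atTop (𝓝 p) :=
    (hlx.sub hly).const_smul _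
  have hla : Tendsto (fun k => 2 * N * (ts (φ k) - ss (φ k))) atTop (𝓝 (2 * N * (t - s))) :=
    (hlt.sub hls).const_mul _
  have key1 : ∀ v, β t + inner ℝ p v + 2 * N * (t - s) ≤ (1 - θ) * F (x, t) v := fun v => by
    have h1 : Tendsto (fun k => (1 - θ) * F (xs (φ k), ts (φ k)) v) atTop
        (𝓝 ((1 - θ) * F (x, t) v)) := by
      have h2 : Continuous fun z : Space d × ℝ => F z v :=
        h.continuous.comp (continuous_id.prodMk continuous_const)
      exact ((h2.tendsto (x, t)).comp (hlx.prodMk_nhds hlt)).const_mul _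
    refine le_of_tendsto_of_tendsto
      ((tendsto_const_nhds.add (hlp.inner tendsto_const_nhds)).add hla) h1 ?_
    filter_upwards [hbt] with k hk
    have := hsub (φ k) v
    linarith
  have key2 : β s + c₀ - 2 * N * (t - s) ≤ G (y, s) (p - (2 * κ) • y) + c₀ / 8 := by
    have h1 := h.hamiltonian_upperSemicontinuous hN₁ hq (y, s) (p - (2 * κ) • y)
      (show 0 < c₀ / 8 by positivity)
    have h2 := ((hly.prodMk_nhds hls).prodMk_nhds
      (hlp.sub (hly.const_smul (2 * κ)))).eventually h1
    refine le_of_tendsto (tendsto_const_nhds.sub hla) ?_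
    filter_upwards [hbs, h2] with k hk hk2
    have := hsup (φ k)
    linarith
  -- One velocity, almost optimal for `G` at the limit point `(y, s)`, is inserted in `key1`. The
  -- sum leaves `β t + β s + 3 c₀ / 4` below a quantity that `sub_penalized_lt` puts under `β t + β
  -- s + c₀ / 2`.
  obtain ⟨v, hv⟩ := h.exists_velocity (y, s) (p - (2 * κ) • y)
    (β s + c₀ - 2 * N * (t - s) - c₀ / 4) (by linarith)
  rw [inner_sub_left, inner_smul_left y v (2 * κ)] at hv
  have hv1 := key1 v
  simp only [RCLike.conj_to_real] at hv
  have hpen : -(2 * κ * inner ℝ y v) ≤ k₁ * ‖v‖ := by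
    have h1 : 2 * κ * ‖y‖ ≤ k₁ := by
      refine le_of_sq_le_sq ?_ hk₁0.le
      calc (2 * κ * ‖y‖) ^ 2 = 4 * κ * (κ * ‖y‖ ^ 2) := by ring
        _ ≤ 4 * κ * (2 * M) := by gcongr
        _ = 8 * M * κ := by ring
        _ ≤ k₁ ^ 2 := hκk
    have h2 := neg_le_of_abs_le (abs_real_inner_le_norm y v)
    have h3 : 2 * κ * -inner ℝ y v ≤ 2 * κ * (‖y‖ * ‖v‖) := by gcongr; linarith
    have h4 : 2 * κ * ‖y‖ * ‖v‖ ≤ k₁ * ‖v‖ := by gcongr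
    linarith
  have hfin := h.sub_penalized_lt hN₁ hq hθ0 hR1 hc₀0 hk₁0.le hk₁R hk₁θ (x := x) (y := y) (t := t)
    (s := s) (v := v) fun hvR => (abs_lt.1 (huc (x, t) (y, s) v v (by linarith) (by linarith) (by
      rw [Prod.dist_eq, max_lt_iff, dist_eq_norm, Real.dist_eq]
      exact ⟨by dsimp only; linarith, by dsimp only; linarith⟩) (by simpa using hδ))).2
  rw [← hm'] at hfin
  simp only [hβ] at hv hv1
  linarith

/-- Viscosity solutions are approximated by the action of piecewise affine paths. -/
theorem IsViscositySolution.exists_action_lt {u : Space d → ℝ → ℝ}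
    (hu : IsViscositySolution (fun x t p => G (x, t) p) u) (h : IsDualPair F G n q N₁ C)
    (hN₁ : 0 < N₁) (hq : 1 < q) (x : Space d) {t : ℝ} (ht : 0 < t) {ε : ℝ} (hε : 0 < ε) :
    ∃ α : ℝ → Space d, IsStep α ∧ action F α x t < u x t + ε := by
  have : Nonempty {α : ℝ → Space d // IsStep α} := ⟨⟨_, IsStep.const 0⟩⟩
  obtain ⟨⟨α, hα⟩, hlt⟩ := exists_lt_of_ciInf_lt
    ((hu.value_le h hN₁ hq x ht).trans_lt (lt_add_of_pos_right _ hε))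
  exact ⟨α, hα, hlt⟩

/-! ### Power inequalities -/

/-- A weighted Young inequality, by comparing `m` with `Γ * a`. A large `Γ` makes the coefficient of
`m ^ q` small, so that term can be absorbed into the saved energy. -/
theorem mul_rpow_sub_one_le {q δ Γ m a : ℝ} (hq : 1 < q) (hΓ : 0 < Γ) (hδ : Γ ^ (q - 1) * δ = 1)
    (hm : 0 ≤ m) (ha : 0 ≤ a) : m * a ^ (q - 1) ≤ δ * m ^ q + Γ * a ^ q := by
  have hδ0 : 0 ≤ δ := by
    by_contra! h
    have : Γ ^ (q - 1) * δ ≤ 0 := mul_nonpos_of_nonneg_of_nonpos (by positivity) h.le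
    linarith
  have e : ∀ b : ℝ, 0 ≤ b → b ^ q = b * b ^ (q - 1) := fun b hb => by
    rw [← Real.rpow_one_add' hb (by linarith)]; ring_nf
  rcases le_total m (Γ * a) with h | h
  · have : m * a ^ (q - 1) ≤ Γ * a * a ^ (q - 1) := by gcongr
    have h2 : 0 ≤ δ * m ^ q := by positivity
    rw [e a ha]; linarith
  · have h1 : (Γ * a) ^ (q - 1) ≤ m ^ (q - 1) := Real.rpow_le_rpow (by positivity) h (by linarith)
    rw [Real.mul_rpow hΓ.le ha] at h1
    have h2 : a ^ (q - 1) ≤ δ * m ^ (q - 1) := by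
      calc a ^ (q - 1) = (Γ ^ (q - 1) * δ) * a ^ (q - 1) := by rw [hδ, one_mul]
        _ = δ * (Γ ^ (q - 1) * a ^ (q - 1)) := by ring
        _ ≤ _ := by gcongr
    have h3 : m * a ^ (q - 1) ≤ m * (δ * m ^ (q - 1)) := by gcongr
    have h4 : 0 ≤ Γ * a ^ q := by positivity
    rw [e m hm]; linarith

theorem rpow_sub_one_le {q a : ℝ} (hq : 1 < q) (ha : 0 ≤ a) : a ^ (q - 1) ≤ a ^ q + 1 := by
  rcases le_total a 1 with h | h
  · have h1 : a ^ (q - 1) ≤ 1 := Real.rpow_le_one ha h (by linarith)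
    have h2 : 0 ≤ a ^ q := by positivity
    linarith
  · have : a ^ (q - 1) ≤ a ^ q := Real.rpow_le_rpow_of_exponent_le h (by linarith)
    linarith

theorem add_rpow_le {p a b : ℝ} (hp : 0 ≤ p) (ha : 0 ≤ a) (hb : 0 ≤ b) :
    (a + b) ^ p ≤ 2 ^ p * (a ^ p + b ^ p) := by
  have h1 : (a + b) ^ p ≤ (2 * max a b) ^ p := by
    refine Real.rpow_le_rpow (by positivity) ?_ hp
    linarith [le_max_left a b, le_max_right a b]
  rw [Real.mul_rpow (by norm_num) (ha.trans (le_max_left _ _))] at h1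
  refine h1.trans ?_
  gcongr
  rcases le_total a b with h | h
  · rw [max_eq_right h]; have : 0 ≤ a ^ p := by positivity
    linarith
  · rw [max_eq_left h]; have : 0 ≤ b ^ p := by positivity
    linarith

/-- Jensen's inequality for the mean of a nonnegative function. -/
theorem mul_mean_rpow_le {q a b : ℝ} {f : ℝ → ℝ} (hq : 1 < q) (hab : a < b) (hf0 : ∀ r, 0 ≤ f r)
    (hf : IntervalIntegrable f volume a b)
    (hfq : IntervalIntegrable (fun r => f r ^ q) volume a b) :
    (b - a) * ((∫ r in a..b, f r) / (b - a)) ^ q ≤ ∫ r in a..b, f r ^ q := by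
  have hba : 0 < b - a := sub_pos.2 hab
  set m : ℝ := (∫ r in a..b, f r) / (b - a) with hm
  have hm0 : 0 ≤ m := div_nonneg (intervalIntegral.integral_nonneg hab.le fun r _ => hf0 r) hba.le
  have hI : ∫ r in a..b, f r = (b - a) * m := by rw [hm]; field_simp
  have e : m ^ q = m ^ (q - 1) * m := by
    rw [← Real.rpow_add_one' hm0 (by linarith)]; ring_nf
  -- Young's inequality is here the tangent line of the `q`-th power at the mean; it is then
  -- integrated.
  have hpt : ∀ r, m ^ (q - 1) * f r ≤ (q - 1) / q * m ^ q + 1 / q * f r ^ q := fun r => by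
    have hpq : (q / (q - 1)).HolderConjugate q := by
      rw [Real.holderConjugate_comm]; exact Real.HolderConjugate.conjExponent hq
    have h1 := Real.young_inequality_of_nonneg (Real.rpow_nonneg hm0 (q - 1)) (hf0 r) hpq
    have hq1 : q - 1 ≠ 0 := by linarith
    rw [← Real.rpow_mul hm0, mul_div_cancel₀ _ hq1] at h1
    refine h1.trans_eq ?_
    have : q ≠ 0 := by linarith
    field_simp
  have h2 := intervalIntegral.integral_mono_on hab.le (hf.const_mul (m ^ (q - 1)))
    (intervalIntegrable_const.add (hfq.const_mul (1 / q))) fun r _ => hpt r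
  rw [intervalIntegral.integral_const_mul, intervalIntegral.integral_add intervalIntegrable_const
    (hfq.const_mul _), intervalIntegral.integral_const_mul (1 / q), intervalIntegral.integral_const,
    hI, smul_eq_mul] at h2
  have h3 : m ^ (q - 1) * ((b - a) * m) = (b - a) * m ^ q := by rw [e]; ring
  rw [h3] at h2
  have hq0 : 0 < q := by linarith
  have h4 : (b - a) * ((q - 1) / q * m ^ q) = (b - a) * m ^ q - 1 / q * ((b - a) * m ^ q) := by
    field_simp
  rw [h4] at h2
  have h5 : 1 / q * ((b - a) * m ^ q) ≤ 1 / q * ∫ r in a..b, f r ^ q := by linarith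
  exact le_of_mul_le_mul_left h5 (by positivity)

/-! ### Bending almost optimal paths -/

variable {d : ℕ} {F G : Space d × ℝ → Space d → ℝ} {n : ℝ → ℝ} {q N₁ C : ℝ}
  {u : Space d → ℝ → ℝ}

/-- Standing still at `x` costs at most `n` per unit time. -/
theorem IsViscositySolution.le_add_integral_of_le
    (hu : IsViscositySolution (fun x t p => G (x, t) p) u) (h : IsDualPair F G n q N₁ C)
    (hq : 1 < q) (x : Space d) {s t : ℝ} (hs : 0 ≤ s) (hst : s ≤ t) :
    u x t ≤ u x s + ∫ r in s..t, n r := by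
  have h1 := hu.le_add_integral_segment h x 0 s t hs hst
  simp only [smul_zero, add_zero] at h1
  refine h1.trans (add_le_add le_rfl ?_)
  refine intervalIntegral.integral_mono_on hst
    (h.intervalIntegrable_comp (IsStep.const 0) continuous_const s t) (h.intervalIntegrable s t)
    fun r _ => ?_
  have := h.upper (x, r) 0
  rwa [norm_zero, Real.zero_rpow (by linarith), mul_zero, zero_add] at this

/-- The upper bound comes from standing still. The lower one comes from comparison, since every
action is at least `-∫ n`. -/
theorem IsViscositySolution.abs_le_integral
    (hu : IsViscositySolution (fun x t p => G (x, t) p) u) (h : IsDualPair F G n q N₁ C)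
    (hN₁ : 0 < N₁) (hq : 1 < q) (x : Space d) {t : ℝ} (ht : 0 < t) :
    |u x t| ≤ ∫ r in (0 : ℝ)..t, n r := by
  have h1 := hu.le_add_integral_of_le h hq x le_rfl ht.le
  rw [hu.initial, zero_add] at h1
  exact abs_le.2 ⟨(h.neg_integral_le_value hN₁ x ht.le).trans (hu.value_le h hN₁ hq x ht), h1⟩

theorem IsDualPair.energy_le (h : IsDualPair F G n q N₁ C) (hq : 1 < q)
    {α : ℝ → Space d} (hα : IsStep α) {γ : ℝ → Space d} (hγ : Continuous γ) {a b : ℝ}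
    (hab : a ≤ b) :
    1 / N₁ * (∫ r in a..b, ‖α r‖ ^ q) - ∫ r in a..b, n r ≤ ∫ r in a..b, F (γ r, r) (α r) := by
  have h1 := (hα.intervalIntegrable_norm_rpow (show 0 ≤ q by linarith) a b).const_mul (1 / N₁)
  rw [← intervalIntegral.integral_const_mul, ← intervalIntegral.integral_sub h1
    (h.intervalIntegrable a b)]
  exact intervalIntegral.integral_mono_on hab (h1.sub (h.intervalIntegrable a b))
    (h.intervalIntegrable_comp hα hγ a b) fun r _ => h.lower (γ r, r) (α r)

/-- The displacement from `x` to `y` is charged to `2 * n t` however large it is; only the change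
`k` of velocity costs more. -/
theorem IsDualPair.sub_le_drift (h : IsDualPair F G n q N₁ C) (hq : 1 < q) (x y v k : Space d)
    (t : ℝ) : F (y, t) (v + k) - F (x, t) v ≤
      |C| * 2 ^ q * ‖k‖ * (‖v‖ ^ (q - 1) + (‖k‖ ^ (q - 1) + 1)) + 2 * n t := by
  have h1 := (abs_le.1 (h.regularity (y, t) (x, t) (v + k) v)).2
  rw [add_sub_cancel_left] at h1
  dsimp only at h1
  have h2 : ‖v + k‖ ^ (q - 1) ≤ 2 ^ (q - 1) * (‖v‖ ^ (q - 1) + ‖k‖ ^ (q - 1)) :=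
    (Real.rpow_le_rpow (norm_nonneg _) (norm_add_le v k) (by linarith)).trans
      (add_rpow_le (by linarith) (norm_nonneg _) (norm_nonneg _))
  have h3 : (2 : ℝ) ^ q = 2 * 2 ^ (q - 1) := by
    rw [← Real.rpow_one_add' (by norm_num) (by linarith)]; ring_nf
  have h4 : (1 : ℝ) ≤ 2 ^ (q - 1) := Real.one_le_rpow (by norm_num) (by linarith)
  have h5 : 0 ≤ ‖v‖ ^ (q - 1) := by positivity
  have h6 : 0 ≤ ‖k‖ ^ (q - 1) := by positivity
  have h7 : ‖v + k‖ ^ (q - 1) + ‖v‖ ^ (q - 1) + 1 ≤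
      2 ^ q * (‖v‖ ^ (q - 1) + (‖k‖ ^ (q - 1) + 1)) := by
    rw [h3]
    nlinarith [mul_le_mul_of_nonneg_right h4 h5, mul_le_mul_of_nonneg_right h4 h6]
  have h8 : C * ‖k‖ * (‖v + k‖ ^ (q - 1) + ‖v‖ ^ (q - 1) + 1) ≤
      |C| * ‖k‖ * (2 ^ q * (‖v‖ ^ (q - 1) + (‖k‖ ^ (q - 1) + 1))) := by
    gcongr
    exact le_abs_self C
  linarith

/-- Bending an almost optimal path on `[a, s]` so that it hits `z` at time `s`. -/
theorem IsViscositySolution.le_add_drift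
    (hu : IsViscositySolution (fun x t p => G (x, t) p) u) (h : IsDualPair F G n q N₁ C)
    (hq : 1 < q) {α : ℝ → Space d} (hα : IsStep α) {x : Space d} {t ε : ℝ}
    (hact : action F α x t ≤ u x t + ε) (z : Space d) {a s : ℝ} (ha : 0 ≤ a) (has : a < s)
    (hst : s ≤ t) {D k : ℝ} (hD : D = |C| * 2 ^ q) (hk : k = ‖z - pathTo α x t s‖ / (s - a)) :
    u z s ≤ u x t + ε - 1 / N₁ * (∫ r in s..t, ‖α r‖ ^ q) + 2 * (∫ r in a..t, n r) +
      D * k * (∫ r in a..s, ‖α r‖ ^ (q - 1)) + D * k * (k ^ (q - 1) + 1) * (s - a) := by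
  have hsa : 0 < s - a := sub_pos.2 has
  set γ := pathTo α x t with hγ
  have hγc : Continuous γ := hα.continuous_pathTo x t
  -- With this drift the bent path leaves the old one at time `a` and reaches `z` at time `s`.
  set w : Space d := (1 / (s - a)) • (z - γ s) with hw
  have hwk : ‖w‖ = k := by
    rw [hw, norm_smul, Real.norm_of_nonneg (by positivity), hk]; ring
  have hβ := hα.add (IsStep.const w)
  have hend : pathTo (fun r => α r + w) z s a = γ a := by
    have h1 := hα.pathTo_sub x t s a
    rw [pathTo, intervalIntegral.integral_add (hα.intervalIntegrable _ _) intervalIntegrable_const,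
      ← h1, intervalIntegral.integral_const, hw, smul_smul, mul_one_div, div_self hsa.ne', one_smul]
    abel
  have e1 := hu.le_add_integral h hβ z (t := s) ha has.le
  rw [pathTo_self, hend] at e1
  have e2 := hu.le_add_integral h hα x (t := t) le_rfl ha
  rw [hu.initial, zero_add] at e2
  have hi : ∀ a b, IntervalIntegrable (fun r => F (γ r, r) (α r)) volume a b :=
    h.intervalIntegrable_comp hα hγc
  have e3 : action F α x t = (∫ r in (0 : ℝ)..a, F (γ r, r) (α r)) +
      (∫ r in a..s, F (γ r, r) (α r)) + ∫ r in s..t, F (γ r, r) (α r) := by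
    rw [intervalIntegral.integral_add_adjacent_intervals (hi _ _) (hi _ _),
      intervalIntegral.integral_add_adjacent_intervals (hi _ _) (hi _ _)]
    rfl
  have e4 := h.energy_le hq hα hγc hst
  have hi2 := h.intervalIntegrable_comp hβ (hβ.continuous_pathTo z s) a s
  have hi3 := hα.intervalIntegrable_norm_rpow (show 0 ≤ q - 1 by linarith) a s
  have hi4 : IntervalIntegrable (fun r => D * k * (‖α r‖ ^ (q - 1) + (k ^ (q - 1) + 1)))
      volume a s := (hi3.add intervalIntegrable_const).const_mul _
  have e5 := intervalIntegral.integral_mono_on has.le (hi2.sub (hi a s))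
    (hi4.add ((h.intervalIntegrable a s).const_mul 2)) fun r _ => by
      have := h.sub_le_drift hq (γ r) (pathTo (fun r => α r + w) z s r) (α r) w r
      rwa [hwk, ← hD] at this
  rw [intervalIntegral.integral_sub hi2 (hi a s), intervalIntegral.integral_add hi4
    ((h.intervalIntegrable a s).const_mul 2), intervalIntegral.integral_const_mul,
    intervalIntegral.integral_const_mul, intervalIntegral.integral_add hi3 intervalIntegrable_const,
    intervalIntegral.integral_const, smul_eq_mul] at e5
  have e6 := intervalIntegral.integral_add_adjacent_intervals (h.intervalIntegrable a s)
    (h.intervalIntegrable s t)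
  have e7 : 0 ≤ ∫ r in s..t, n r := intervalIntegral.integral_nonneg hst fun r _ => h.nonneg r
  linarith

/-- Bending an almost optimal path so that it already hits its end point at an earlier time. -/
theorem IsViscositySolution.le_add_of_earlier
    (hu : IsViscositySolution (fun x t p => G (x, t) p) u) (h : IsDualPair F G n q N₁ C)
    (hN₁ : 0 < N₁) (hq : 1 < q) {α : ℝ → Space d} (hα : IsStep α) {x : Space d} {t ε : ℝ}
    (hact : action F α x t ≤ u x t + ε) {a s : ℝ} (ha : 0 ≤ a) (hst : s < t) {D δ Γ : ℝ}
    (hD : D = |C| * 2 ^ q) (hΓ : 1 ≤ Γ) (hδ : Γ ^ (q - 1) * δ = 1) (hDδ : 3 * (D * δ) ≤ 1 / (2 * N₁))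
    (has : Γ * (t - s) ≤ s - a) :
    u x s ≤ u x t + ε + 2 * (∫ r in a..t, n r) - 1 / (2 * N₁) * (∫ r in s..t, ‖α r‖ ^ q) +
      D * Γ * (t - s) * ((∫ r in a..t, ‖α r‖ ^ q) / (s - a) + 1) := by
  have hσ : 0 < t - s := sub_pos.2 hst
  have hsa : 0 < s - a := lt_of_lt_of_le (by positivity) has
  have hD0 : 0 ≤ D := by rw [hD]; positivity
  have hΓ0 : 0 < Γ := by linarith
  have hδ0 : 0 ≤ δ := by
    by_contra! h
    have : Γ ^ (q - 1) * δ ≤ 0 := mul_nonpos_of_nonneg_of_nonpos (by positivity) h.le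
    linarith
  have hiq : ∀ a b, IntervalIntegrable (fun r => ‖α r‖ ^ q) volume a b := fun a b =>
    hα.intervalIntegrable_norm_rpow (by linarith) a b
  have hiq1 := hα.intervalIntegrable_norm_rpow (show 0 ≤ q - 1 by linarith) a s
  have hi : IntervalIntegrable (fun r => ‖α r‖) volume s t := (hα.intervalIntegrable s t).norm
  set m : ℝ := (∫ r in s..t, ‖α r‖) / (t - s) with hm
  have hI0 : 0 ≤ ∫ r in s..t, ‖α r‖ :=
    intervalIntegral.integral_nonneg hst.le fun r _ => norm_nonneg _
  have hm0 : 0 ≤ m := div_nonneg hI0 hσ.le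
  have hJ : (t - s) * m ^ q ≤ ∫ r in s..t, ‖α r‖ ^ q :=
    mul_mean_rpow_le hq hst (fun r => norm_nonneg _) hi (hiq s t)
  set k : ℝ := ‖x - pathTo α x t s‖ / (s - a) with hk
  have hk0 : 0 ≤ k := by positivity
  -- The distance to make up is at most the length of the discarded final piece. As the window is at
  -- least `Γ` times longer, the drift is at most `m / Γ`.
  have hkm : k * (s - a) ≤ m * (t - s) := by
    rw [hk, hm, div_mul_cancel₀ _ hsa.ne', div_mul_cancel₀ _ hσ.ne']
    have := hα.pathTo_sub x t t s
    rw [pathTo_self] at this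
    rw [this]
    exact intervalIntegral.norm_integral_le_integral_norm hst.le
  set E : ℝ := ∫ r in s..t, ‖α r‖ ^ q with hE
  set E' : ℝ := ∫ r in a..t, ‖α r‖ ^ q with hE'
  have hEE : (∫ r in a..s, ‖α r‖ ^ q) ≤ E' := by
    have h1 := intervalIntegral.integral_add_adjacent_intervals (hiq a s) (hiq s t)
    have h2 : 0 ≤ E := intervalIntegral.integral_nonneg hst.le fun r _ => by positivity
    linarith
  have hmain := hu.le_add_drift h hq hα hact x ha (sub_pos.1 hsa) hst.le hD hk
  have hkΓ : Γ * k ≤ m := by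
    have h1 : Γ * k * (t - s) ≤ m * (t - s) := by
      calc Γ * k * (t - s) = k * (Γ * (t - s)) := by ring
        _ ≤ k * (s - a) := by gcongr
        _ ≤ _ := hkm
    exact le_of_mul_le_mul_right h1 hσ
  have hJδ : δ * ((t - s) * m ^ q) ≤ δ * E := mul_le_mul_of_nonneg_left hJ hδ0
  have t1 : k * (∫ r in a..s, ‖α r‖ ^ (q - 1)) ≤ δ * E + Γ * ((t - s) * (E' / (s - a))) := by
    have h1 : m * (∫ r in a..s, ‖α r‖ ^ (q - 1)) ≤ (s - a) * (δ * m ^ q) + Γ * E' := by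
      have h2 := intervalIntegral.integral_mono_on (sub_pos.1 hsa).le (hiq1.const_mul m)
        ((intervalIntegrable_const (c := δ * m ^ q)).add ((hiq a s).const_mul Γ)) fun r _ =>
          mul_rpow_sub_one_le hq hΓ0 hδ hm0 (norm_nonneg (α r))
      rw [intervalIntegral.integral_const_mul, intervalIntegral.integral_add
        intervalIntegrable_const ((hiq a s).const_mul Γ), intervalIntegral.integral_const_mul Γ,
        intervalIntegral.integral_const, smul_eq_mul] at h2
      have h3 := mul_le_mul_of_nonneg_left hEE hΓ0.le
      linarith
    have h2 : 0 ≤ ∫ r in a..s, ‖α r‖ ^ (q - 1) :=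
      intervalIntegral.integral_nonneg (sub_pos.1 hsa).le fun r _ => by positivity
    have h3 : k ≤ m * (t - s) / (s - a) := by rw [le_div_iff₀ hsa]; exact hkm
    calc k * (∫ r in a..s, ‖α r‖ ^ (q - 1))
        ≤ m * (t - s) / (s - a) * (∫ r in a..s, ‖α r‖ ^ (q - 1)) := by gcongr
      _ = (t - s) / (s - a) * (m * (∫ r in a..s, ‖α r‖ ^ (q - 1))) := by ring
      _ ≤ (t - s) / (s - a) * ((s - a) * (δ * m ^ q) + Γ * E') := by gcongr
      _ = δ * ((t - s) * m ^ q) + Γ * ((t - s) * (E' / (s - a))) := by field_simp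
      _ ≤ _ := by linarith
  have t2 : k * k ^ (q - 1) * (s - a) ≤ δ * E := by
    have h1 : k ^ (q - 1) ≤ δ * m ^ (q - 1) := by
      calc k ^ (q - 1) = Γ ^ (q - 1) * δ * k ^ (q - 1) := by rw [hδ, one_mul]
        _ = δ * (Γ * k) ^ (q - 1) := by rw [Real.mul_rpow hΓ0.le hk0]; ring
        _ ≤ δ * m ^ (q - 1) := by
          gcongr
    calc k * k ^ (q - 1) * (s - a) = k * (s - a) * k ^ (q - 1) := by ring
      _ ≤ m * (t - s) * (δ * m ^ (q - 1)) := by gcongr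
      _ = δ * ((t - s) * (m * m ^ (q - 1))) := by ring
      _ = δ * ((t - s) * m ^ q) := by
        rw [← Real.rpow_one_add' hm0 (by linarith)]; ring_nf
      _ ≤ _ := hJδ
  have t3 : k * (s - a) ≤ δ * E + Γ * (t - s) := by
    have h1 := mul_rpow_sub_one_le hq hΓ0 hδ hm0 zero_le_one
    rw [Real.one_rpow, Real.one_rpow, mul_one, mul_one] at h1
    calc k * (s - a) ≤ m * (t - s) := hkm
      _ ≤ (δ * m ^ q + Γ) * (t - s) := by gcongr
      _ = δ * ((t - s) * m ^ q) + Γ * (t - s) := by ring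
      _ ≤ _ := by linarith
  have hsum : D * (k * (∫ r in a..s, ‖α r‖ ^ (q - 1)) + k * k ^ (q - 1) * (s - a) + k * (s - a)) ≤
      D * (3 * (δ * E) + Γ * (t - s) * (E' / (s - a) + 1)) :=
    mul_le_mul_of_nonneg_left (by linarith) hD0
  have hE0 : 0 ≤ E := intervalIntegral.integral_nonneg hst.le fun r _ => by positivity
  -- The three drift terms each produced `δ * E`; together they use at most half of the energy saved
  -- on `[s, t]`.
  have habs : 3 * (D * δ) * E ≤ 1 / (2 * N₁) * E := mul_le_mul_of_nonneg_right hDδ hE0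
  have hhalf : 1 / N₁ * E = 1 / (2 * N₁) * E + 1 / (2 * N₁) * E := by field_simp; ring
  linarith

/-- Energy decay across scales for an almost optimal path. -/
theorem IsViscositySolution.energy_le_pow
    (hu : IsViscositySolution (fun x t p => G (x, t) p) u) (h : IsDualPair F G n q N₁ C)
    (hN₁ : 1 < N₁) (hq : 1 < q) {α : ℝ → Space d} (hα : IsStep α) {x : Space d} {t ε : ℝ}
    (hact : action F α x t ≤ u x t + ε) {D δ Γ A ρ τ : ℝ}
    (hD : D = |C| * 2 ^ q) (hΓ : 1 ≤ Γ) (hδ : Γ ^ (q - 1) * δ = 1) (hDδ : 3 * (D * δ) ≤ 1 / (2 * N₁))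
    (hρ : Γ ≤ ρ) (hτ : 0 < τ) (hε : ε ≤ τ) (hA : 1 ≤ A)
    (hnA : ∀ a, 0 ≤ a → a ≤ t - τ → ∫ r in a..t, n r ≤ A * (t - a)) (j : ℕ) {σ : ℝ} (hτσ : τ ≤ σ)
    (hσt : σ ≤ t) (htσ : t ≤ σ * (ρ + 1) ^ j) :
    ∫ r in (t - σ)..t, ‖α r‖ ^ q ≤ (2 * N₁ * (7 + 3 * (D * Γ))) ^ j * (6 * N₁ * ρ * A) * σ := by
  have hN₁0 : 0 < N₁ := by linarith
  have hD0 : 0 ≤ D := by rw [hD]; positivity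
  have hρ1 : 1 ≤ ρ := hΓ.trans hρ
  have hDΓ : 0 ≤ D * Γ := by positivity
  have hiq : ∀ a b, IntervalIntegrable (fun r => ‖α r‖ ^ q) volume a b := fun a b =>
    hα.intervalIntegrable_norm_rpow (by linarith) a b
  have ht0 : 0 < t := by linarith
  have htot : ∫ r in (0 : ℝ)..t, ‖α r‖ ^ q ≤ 3 * N₁ * A * t := by
    have h1 := h.energy_le hq hα (hα.continuous_pathTo x t) ht0.le
    have h2 := (abs_le.1 (hu.abs_le_integral h hN₁0 hq x ht0)).2
    have h3 := hnA 0 le_rfl (by linarith)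
    rw [sub_zero] at h3
    have h4 : ε ≤ A * t := by nlinarith
    have h5 : 1 / N₁ * (∫ r in (0 : ℝ)..t, ‖α r‖ ^ q) ≤ 3 * (A * t) := by
      rw [action] at hact; linarith
    rw [one_div, inv_mul_le_iff₀ hN₁0] at h5
    linarith
  have hbig : ∀ σ, τ ≤ σ → σ ≤ t → t ≤ σ * (ρ + 1) →
      ∫ r in (t - σ)..t, ‖α r‖ ^ q ≤ 6 * N₁ * ρ * A * σ := fun σ h1 h2 h3 => by
    have h4 : ∫ r in (t - σ)..t, ‖α r‖ ^ q ≤ ∫ r in (0 : ℝ)..t, ‖α r‖ ^ q :=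
      intervalIntegral.integral_mono_interval (by linarith) (by linarith) le_rfl
        (ae_of_all _ fun r => by positivity) (hiq _ _)
    have hσ0 : 0 < σ := by linarith
    calc _ ≤ 3 * N₁ * A * t := h4.trans htot
      _ ≤ 3 * N₁ * A * (σ * (ρ + 1)) := by gcongr
      _ ≤ 3 * N₁ * A * (σ * (ρ + ρ)) := by gcongr
      _ = _ := by ring
  have hg1 : 1 ≤ 2 * N₁ * (7 + 3 * (D * Γ)) := by nlinarith
  induction j generalizing σ with
  | zero =>
    rw [pow_zero, mul_one] at htσ
    rw [pow_zero, one_mul]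
    exact hbig σ hτσ hσt (by nlinarith)
  | succ j ih =>
    have hσ0 : 0 < σ := by linarith
    have hX : ρ * A ≤ 6 * N₁ * ρ * A := by
      have : 0 ≤ ρ * A := by positivity
      nlinarith
    have hP : 1 ≤ (2 * N₁ * (7 + 3 * (D * Γ))) ^ j := one_le_pow₀ hg1
    set P := (2 * N₁ * (7 + 3 * (D * Γ))) ^ j with hPdef
    have hX0 : 0 ≤ 6 * N₁ * ρ * A := by positivity
    rcases le_total t (σ * (ρ + 1)) with hc | hc
    · refine (hbig σ hτσ hσt hc).trans ?_
      have h2 : 1 ≤ (2 * N₁ * (7 + 3 * (D * Γ))) ^ (j + 1) := one_le_pow₀ hg1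
      have h3 : 0 ≤ 6 * N₁ * ρ * A * σ := by positivity
      nlinarith
    · have hσρ : σ ≤ σ * ρ := le_mul_of_one_le_right hσ0.le hρ1
      have hE' := ih (σ := σ * (ρ + 1)) (by linarith) hc (by rw [pow_succ] at htσ; linarith)
      set X := P * (6 * N₁ * ρ * A) with hXdef
      have hXρ : ρ * A ≤ X := hX.trans (le_mul_of_one_le_left hX0 hP)
      have hb : (t - σ) - (t - σ * (ρ + 1)) = σ * ρ := by ring
      have h1 := hu.le_add_of_earlier h hN₁0 hq hα hact (a := t - σ * (ρ + 1)) (s := t - σ)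
        (by linarith) (by linarith) hD hΓ hδ hDδ (by
          rw [hb, sub_sub_cancel, mul_comm]; gcongr)
      rw [hb, sub_sub_cancel] at h1
      have h2 := hu.le_add_integral_of_le h hq x (s := t - σ) (t := t) (by linarith) (by linarith)
      have h3 := hnA (t - σ * (ρ + 1)) (by linarith) (by linarith)
      have h4 : ∫ r in (t - σ)..t, n r ≤ ∫ r in (t - σ * (ρ + 1))..t, n r :=
        intervalIntegral.integral_mono_interval (by linarith) (by linarith) le_rfl
          (ae_of_all _ fun r => h.nonneg r) (h.intervalIntegrable _ _)
      rw [sub_sub_cancel] at h3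
      have h5 : (∫ r in (t - σ * (ρ + 1))..t, ‖α r‖ ^ q) / (σ * ρ) ≤ 2 * X := by
        rw [div_le_iff₀ (by positivity)]
        refine hE'.trans ?_
        have : X * (σ * (ρ + 1)) ≤ X * (σ * (ρ + ρ)) := by
          have : 0 ≤ X := by positivity
          gcongr
        linarith
      have h6 : A ≤ X := (le_mul_of_one_le_left (by linarith) hρ1).trans hXρ
      have h7 : D * Γ * σ * ((∫ r in (t - σ * (ρ + 1))..t, ‖α r‖ ^ q) / (σ * ρ) + 1) ≤
          D * Γ * σ * (3 * X) := by
        gcongr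
        linarith
      have h8 : A * (σ * (ρ + 1)) ≤ 2 * (X * σ) := by
        have e1 := mul_le_mul_of_nonneg_right hXρ hσ0.le
        have e2 := mul_le_mul_of_nonneg_right h6 hσ0.le
        linarith
      have h9 : ε ≤ X * σ := by
        have := le_mul_of_one_le_left hσ0.le (hA.trans h6)
        linarith
      -- Here `7 = 1 + 6`: one `X * σ` for `ε`, and two for each of three integrals of `n`, two from
      -- bending and one from standing still on the last piece.
      have h10 : 1 / (2 * N₁) * (∫ r in (t - σ)..t, ‖α r‖ ^ q) ≤ (7 + 3 * (D * Γ)) * (X * σ) := by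
        linarith
      rw [one_div, inv_mul_le_iff₀ (by positivity)] at h10
      refine h10.trans_eq ?_
      rw [pow_succ, hXdef]; ring

/-! ### Choice of constants and averages of the error -/

theorem one_le_phi {c q r : ℝ} (hc : 0 ≤ c) (hr : 1 ≤ r) : 1 ≤ phi c q r := by
  have := Real.log_nonneg hr
  exact Real.one_le_exp (by positivity)

/-- The exponent `1 / min 2 q` lies between `1 / 2` and `1`, and `log r ≥ 1 / 2` for `r ≥ 2`. So the
power of the logarithm dominates both its square root and a constant, and `c₁` absorbs the
prefactor. -/
theorem exists_mul_exp_sqrt_log_le_phi {q K c : ℝ} (hq : 1 < q) (hK : 0 ≤ K) (hc : 0 ≤ c) :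
    ∃ c₁ : ℝ, 0 < c₁ ∧ ∀ r, 2 ≤ r → K * Real.exp (c * √(Real.log r)) ≤ phi c₁ q r := by
  refine ⟨2 * K + 2 * c + 1, by positivity, fun r hr => ?_⟩
  set l := Real.log r with hl
  have hl2 : 1 / 2 ≤ l := by
    have h1 := Real.log_two_gt_d9
    have h2 := Real.log_le_log (by norm_num) hr
    linarith
  have hl0 : 0 < l := by linarith
  set p : ℝ := 1 / min 2 q with hp
  have hm : 1 < min 2 q := lt_min (by norm_num) hq
  have hp1 : p ≤ 1 := by rw [hp, div_le_one (by linarith)]; exact hm.le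
  have hp2 : 1 / 2 ≤ p := one_div_le_one_div_of_le (by linarith) (min_le_left _ _)
  have hlp : 1 / 2 ≤ l ^ p := by
    rcases le_total 1 l with h | h
    · have := Real.one_le_rpow h (show 0 ≤ p by linarith)
      linarith
    · have := Real.rpow_le_rpow_of_exponent_ge hl0 h hp1
      rw [Real.rpow_one] at this
      linarith
  have hsq : √l ≤ 2 * l ^ p := by
    rcases le_total 1 l with h | h
    · rw [Real.sqrt_eq_rpow]
      have := Real.rpow_le_rpow_of_exponent_le h hp2
      have h2 : 0 ≤ l ^ p := by positivity
      linarith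
    · have : √l ≤ 1 := Real.sqrt_le_one.2 h
      linarith
  have hKe : K ≤ Real.exp K := by linarith [Real.add_one_le_exp K]
  calc K * Real.exp (c * √l) ≤ Real.exp K * Real.exp (c * √l) := by gcongr
    _ = Real.exp (K + c * √l) := by rw [Real.exp_add]
    _ ≤ phi (2 * K + 2 * c + 1) q r := by
      refine Real.exp_le_exp.2 ?_
      rw [← hl, ← hp]
      have h1 : K * 1 ≤ K * (2 * l ^ p) := by gcongr; linarith
      have h2 : c * √l ≤ c * (2 * l ^ p) := by gcongr
      linarith

theorem exists_young_constants {N₁ q D : ℝ} (hN₁ : 0 < N₁) (hq : 1 < q) (hD : 0 ≤ D) :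
    ∃ Γ δ : ℝ, 1 ≤ Γ ∧ Γ ^ (q - 1) * δ = 1 ∧ 3 * (D * δ) ≤ 1 / (2 * N₁) := by
  have hM : 0 < 6 * N₁ * D + 1 := by positivity
  refine ⟨(6 * N₁ * D + 1) ^ (1 / (q - 1)), 1 / (6 * N₁ * D + 1), ?_, ?_, ?_⟩
  · refine Real.one_le_rpow ?_ (one_div_nonneg.2 (by linarith))
    have : 0 ≤ 6 * N₁ * D := by positivity
    linarith
  · rw [← Real.rpow_mul hM.le, one_div_mul_cancel (by linarith), Real.rpow_one]
    field_simp
  · rw [le_div_iff₀ (by positivity), mul_one_div, mul_div_assoc', div_mul_eq_mul_div,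
      div_le_one hM]
    linarith

theorem cutoff_rpow {N₁ q t : ℝ} {n : ℝ → ℝ} (hN₁ : 0 ≤ N₁) (hq : 1 < q) (ht : 0 < t)
    (hn0 : ∀ r, 0 ≤ n r) : cutoff N₁ q n t ^ q = 4 * N₁ * ((∫ r in (0 : ℝ)..t, n r) / t) := by
  have h0 : 0 ≤ ∫ r in (0 : ℝ)..t, n r := intervalIntegral.integral_nonneg ht.le fun r _ => hn0 r
  have h1 : (⨍ r in (0 : ℝ)..t, n r) = (∫ r in (0 : ℝ)..t, n r) / t := by
    rw [interval_average_eq, sub_zero, smul_eq_mul]; ring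
  rw [cutoff, h1, ← Real.rpow_mul (by positivity), one_div_mul_cancel (by linarith), Real.rpow_one]

theorem supAverage_nonneg {n : ℝ → ℝ} (hn0 : ∀ r, 0 ≤ n r) {b t : ℝ} (hb : b ≤ t) (ht : 0 ≤ t) :
    0 ≤ supAverage n b t := by
  refine Real.iSup_nonneg fun w => ?_
  have hw : max (w : ℝ) 0 ≤ t := max_le (w.2.trans hb) ht
  rw [interval_average_eq, smul_eq_mul]
  exact mul_nonneg (inv_nonneg.2 (by linarith))
    (intervalIntegral.integral_nonneg hw fun r _ => hn0 r)

/-- The strict inequality `b < t` keeps the averaging windows from shrinking to a point, which makes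
the supremum one of a bounded family. -/
theorem integral_le_supAverage_mul {n : ℝ → ℝ} (hn0 : ∀ r, 0 ≤ n r)
    (hn : ∀ a b, IntervalIntegrable n volume a b) {a b t : ℝ} (ha : 0 ≤ a) (hab : a ≤ b)
    (hbt : b < t) : ∫ r in a..t, n r ≤ supAverage n b t * (t - a) := by
  have hbdd : BddAbove (range fun w : Iic b => ⨍ r in (max (w : ℝ) 0)..t, n r) := by
    refine ⟨(t - b)⁻¹ * ∫ r in (0 : ℝ)..t, n r, ?_⟩
    rintro _ ⟨w, rfl⟩
    have h1 : max (w : ℝ) 0 ≤ b := max_le w.2 (ha.trans hab)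
    dsimp only
    rw [interval_average_eq, smul_eq_mul]
    have h2 : 0 < t - b := by linarith
    gcongr
    · exact intervalIntegral.integral_nonneg (h1.trans hbt.le) fun r _ => hn0 r
    · exact intervalIntegral.integral_mono_interval (le_max_right _ _) (h1.trans hbt.le) le_rfl
        (ae_of_all _ hn0) (hn _ _)
  have h1 : (⨍ r in (max a 0)..t, n r) ≤ supAverage n b t :=
    le_ciSup hbdd (⟨a, hab⟩ : Iic b)
  rw [max_eq_left ha, interval_average_eq, smul_eq_mul,
    inv_mul_le_iff₀ (by linarith : (0 : ℝ) < t - a)] at h1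
  linarith

/-! ### Energy at the smallest scale and the two regularity estimates -/

variable {d : ℕ} {F G : Space d × ℝ → Space d → ℝ} {n : ℝ → ℝ} {q N₁ C : ℝ}
  {u : Space d → ℝ → ℝ}

/-- Optimization of `energy_le_pow`: `ρ = Γ exp √(log r)` and `⌈√(log r)⌉` iterations reach scale
`τ`, and both resulting factors are exponentials of `√(log r)`. -/
theorem IsViscositySolution.energy_le_exp
    (hu : IsViscositySolution (fun x t p => G (x, t) p) u) (h : IsDualPair F G n q N₁ C)
    (hN₁ : 1 < N₁) (hq : 1 < q) {α : ℝ → Space d} (hα : IsStep α) {x : Space d} {t ε : ℝ}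
    (hact : action F α x t ≤ u x t + ε) {D δ Γ A r τ : ℝ}
    (hD : D = |C| * 2 ^ q) (hΓ : 1 ≤ Γ) (hδ : Γ ^ (q - 1) * δ = 1) (hDδ : 3 * (D * δ) ≤ 1 / (2 * N₁))
    (hτ : 0 < τ) (hε : ε ≤ τ) (hA : 1 ≤ A)
    (hnA : ∀ a, 0 ≤ a → a ≤ t - τ → ∫ r in a..t, n r ≤ A * (t - a)) (hτt : τ ≤ t) (hr : 1 ≤ r)
    (htr : t ≤ τ * r) :
    ∫ r in (t - τ)..t, ‖α r‖ ^ q ≤ 2 * N₁ * (7 + 3 * (D * Γ)) * (6 * N₁ * Γ) *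
      Real.exp ((Real.log (2 * N₁ * (7 + 3 * (D * Γ))) + 1) * √(Real.log r)) * A * τ := by
  have hD0 : 0 ≤ D := by rw [hD]; positivity
  have hDΓ : 0 ≤ D * Γ := by positivity
  have hl0 : 0 ≤ Real.log r := Real.log_nonneg hr
  set l := √(Real.log r) with hl
  have hl1 : 0 ≤ l := Real.sqrt_nonneg _
  have hll : l * l = Real.log r := Real.mul_self_sqrt hl0
  set ρ := Γ * Real.exp l with hρ
  have hel := Real.one_le_exp hl1
  have hΓρ : Γ ≤ ρ := le_mul_of_one_le_right (by linarith) hel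
  have hρe : Real.exp l ≤ ρ + 1 := by
    have : Real.exp l ≤ Γ * Real.exp l := le_mul_of_one_le_left (by linarith) hΓ
    linarith
  have hjr : r ≤ (ρ + 1) ^ ⌈l⌉₊ := by
    calc r = Real.exp (l * l) := by rw [hll, Real.exp_log (by linarith)]
      _ ≤ Real.exp (⌈l⌉₊ * l) := by gcongr; exact Nat.le_ceil l
      _ = Real.exp l ^ ⌈l⌉₊ := by rw [Real.exp_nat_mul]
      _ ≤ _ := by gcongr
  have hmain := hu.energy_le_pow h hN₁ hq hα hact hD hΓ hδ hDδ hΓρ hτ hε hA hnA ⌈l⌉₊ le_rfl hτt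
    (htr.trans (by gcongr))
  refine hmain.trans ?_
  set g := 2 * N₁ * (7 + 3 * (D * Γ)) with hg
  have hg1 : 1 ≤ g := by nlinarith
  have hgj : g ^ ⌈l⌉₊ ≤ g * Real.exp (Real.log g * l) := by
    have h1 : g ^ ⌈l⌉₊ = Real.exp (⌈l⌉₊ * Real.log g) := by
      rw [Real.exp_nat_mul, Real.exp_log (by linarith)]
    have h2 : g * Real.exp (Real.log g * l) = Real.exp ((l + 1) * Real.log g) := by
      rw [add_mul, one_mul, Real.exp_add, Real.exp_log (by linarith)]; ring_nf
    rw [h1, h2]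
    have := Real.log_nonneg hg1
    gcongr
    exact (Nat.ceil_lt_add_one hl1).le
  calc g ^ ⌈l⌉₊ * (6 * N₁ * ρ * A) * τ
      ≤ g * Real.exp (Real.log g * l) * (6 * N₁ * ρ * A) * τ := by gcongr
    _ = g * (6 * N₁ * Γ) * (Real.exp (Real.log g * l) * Real.exp l) * A * τ := by rw [hρ]; ring
    _ = _ := by rw [← Real.exp_add]; ring_nf

/-- The data entering both regularity estimates: the constant `A` dominates all averages of the
error over long intervals that end at `t`. -/
theorem IsDualPair.average_bounds (h : IsDualPair F G n q N₁ C) (hN₁ : 1 < N₁) (hq : 1 < q)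
    {t τ : ℝ} (ht : 0 < t) (hτ : 0 < τ) :
    1 ≤ cutoff N₁ q n t ^ q + supAverage n (t - τ) t ∧
    (∫ r in (0 : ℝ)..t, n r) ≤ (cutoff N₁ q n t ^ q + supAverage n (t - τ) t) * t ∧
    ∀ a, 0 ≤ a → a ≤ t - τ →
      ∫ r in a..t, n r ≤ (cutoff N₁ q n t ^ q + supAverage n (t - τ) t) * (t - a) := by
  have hS := supAverage_nonneg h.nonneg (show t - τ ≤ t by linarith) ht.le
  rw [cutoff_rpow (by linarith) hq ht h.nonneg]
  have hI : t ≤ ∫ r in (0 : ℝ)..t, n r := by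
    have := intervalIntegral.integral_mono_on ht.le (intervalIntegrable_const (c := (1 : ℝ)))
      (h.intervalIntegrable 0 t) fun r _ => h.one_le r
    simpa using this
  set J := (∫ r in (0 : ℝ)..t, n r) / t with hJ
  have hJt : J * t = ∫ r in (0 : ℝ)..t, n r := by rw [hJ]; field_simp
  have hJ1 : 1 ≤ J := by rw [hJ, le_div_iff₀ ht]; linarith
  have hNJ : J ≤ 4 * N₁ * J := le_mul_of_one_le_left (by linarith) (by linarith)
  refine ⟨by linarith, ?_, fun a ha hat => ?_⟩
  · rw [← hJt]; gcongr; linarith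
  · refine (integral_le_supAverage_mul h.nonneg h.intervalIntegrable ha hat (by linarith)).trans ?_
    have : 0 ≤ t - a := by linarith
    gcongr
    linarith

/-- The path to `x` is bent to `y` over the last `τ` units of time, with drift `‖x - y‖ / τ = 1 /
φ`, which cancels the `φ` of the energy bound. If `t ≤ τ`, the bound of `u` by `∫ n` suffices. -/
theorem IsViscositySolution.sub_le_space
    (hu : IsViscositySolution (fun x t p => G (x, t) p) u) (h : IsDualPair F G n q N₁ C)
    (hN₁ : 1 < N₁) (hq : 1 < q) {D δ Γ c₁ : ℝ}
    (hD : D = |C| * 2 ^ q) (hΓ : 1 ≤ Γ) (hδ : Γ ^ (q - 1) * δ = 1) (hDδ : 3 * (D * δ) ≤ 1 / (2 * N₁))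
    (hc₁ : 0 ≤ c₁) (hφ : ∀ r, 2 ≤ r → 2 * N₁ * (7 + 3 * (D * Γ)) * (6 * N₁ * Γ) *
      Real.exp ((Real.log (2 * N₁ * (7 + 3 * (D * Γ))) + 1) * √(Real.log r)) ≤ phi c₁ q r)
    (x y : Space d) {t : ℝ} (ht : 0 < t) :
    u y t - u x t ≤ (3 + 4 * D) * (‖x - y‖ * phi c₁ q ((t + ‖x - y‖) / ‖x - y‖) *
      (cutoff N₁ q n t ^ q + supAverage n (t - tauSpace c₁ q x y t) t)) := by
  have hN₁0 : 0 < N₁ := by linarith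
  have hD0 : 0 ≤ D := by rw [hD]; positivity
  rcases eq_or_ne x y with rfl | hxy
  · simp
  have hm : 0 < ‖x - y‖ := norm_pos_iff.2 (sub_ne_zero.2 hxy)
  have hr1 : 1 ≤ (t + ‖x - y‖) / ‖x - y‖ := by rw [le_div_iff₀ hm]; linarith
  set r := (t + ‖x - y‖) / ‖x - y‖ with hr
  have hφ1 : 1 ≤ phi c₁ q r := one_le_phi hc₁ hr1
  have hτd : tauSpace c₁ q x y t = ‖x - y‖ * phi c₁ q r := rfl
  rw [hτd]
  set τ := ‖x - y‖ * phi c₁ q r with hτ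
  have hmτ : ‖x - y‖ ≤ τ := le_mul_of_one_le_right hm.le hφ1
  have hτ0 : 0 < τ := by linarith
  obtain ⟨hA1, hA2, hA3⟩ := h.average_bounds hN₁ hq ht hτ0
  set A := cutoff N₁ q n t ^ q + supAverage n (t - τ) t with hA
  have hτA : τ ≤ τ * A := le_mul_of_one_le_right hτ0.le hA1
  rcases le_or_gt t τ with htτ | htτ
  · have h1 := (abs_le.1 (hu.abs_le_integral h hN₁0 hq x ht)).1
    have h2 := (abs_le.1 (hu.abs_le_integral h hN₁0 hq y ht)).2
    have h3 : A * t ≤ A * τ := by gcongr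
    have h4 : 0 ≤ D * (τ * A) := by positivity
    linarith
  · have hr2 : 2 ≤ r := by rw [hr, le_div_iff₀ hm]; linarith
    obtain ⟨α, hα, hact⟩ := hu.exists_action_lt h hN₁0 hq x ht hτ0
    have hE := hu.energy_le_exp h hN₁ hq hα hact.le hD hΓ hδ hDδ hτ0 le_rfl hA1 hA3 htτ.le hr1 (by
      have : ‖x - y‖ * r = t + ‖x - y‖ := by rw [hr]; field_simp
      have : ‖x - y‖ * r ≤ τ * r := by gcongr
      linarith)
    have hE2 : ∫ r in (t - τ)..t, ‖α r‖ ^ q ≤ phi c₁ q r * A * τ := by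
      refine hE.trans ?_
      gcongr
      exact hφ r hr2
    have hmain := hu.le_add_drift h hq hα hact.le y (a := t - τ) (s := t) (by linarith)
      (by linarith) le_rfl hD rfl
    rw [pathTo_self, sub_sub_cancel, intervalIntegral.integral_same, mul_zero, sub_zero,
      norm_sub_rev] at hmain
    set k := ‖x - y‖ / τ with hk
    have hk0 : 0 ≤ k := by positivity
    have hk1 : k ≤ 1 := (div_le_one hτ0).2 hmτ
    have hkτ : k * τ = ‖x - y‖ := by rw [hk]; field_simp
    have hiq := hα.intervalIntegrable_norm_rpow (show 0 ≤ q by linarith) (t - τ) t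
    have h1 : ∫ r in (t - τ)..t, ‖α r‖ ^ (q - 1) ≤ phi c₁ q r * A * τ + τ := by
      have h2 := intervalIntegral.integral_mono_on (by linarith)
        (hα.intervalIntegrable_norm_rpow (show 0 ≤ q - 1 by linarith) (t - τ) t)
        (hiq.add (intervalIntegrable_const (c := (1 : ℝ)))) fun r _ =>
          rpow_sub_one_le hq (norm_nonneg (α r))
      rw [intervalIntegral.integral_add hiq intervalIntegrable_const,
        intervalIntegral.integral_const, sub_sub_cancel, smul_eq_mul, mul_one] at h2
      linarith
    have h2 : D * k * (∫ r in (t - τ)..t, ‖α r‖ ^ (q - 1)) ≤ D * (2 * (τ * A)) := by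
      calc _ ≤ D * k * (phi c₁ q r * A * τ + τ) := by gcongr
        _ = D * (k * τ * phi c₁ q r * A + k * τ) := by ring
        _ = D * (τ * A + ‖x - y‖) := by rw [hkτ]
        _ ≤ D * (2 * (τ * A)) := by gcongr; linarith
    have h3 : D * k * (k ^ (q - 1) + 1) * τ ≤ D * (2 * (τ * A)) := by
      have h4 : k ^ (q - 1) ≤ 1 := Real.rpow_le_one hk0 hk1 (by linarith)
      calc D * k * (k ^ (q - 1) + 1) * τ = D * ((k ^ (q - 1) + 1) * (k * τ)) := by ring
        _ ≤ D * ((1 + 1) * (τ * A)) := by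
          rw [hkτ]; gcongr; linarith
        _ = _ := by ring
    have h5 := hA3 (t - τ) (by linarith) le_rfl
    rw [sub_sub_cancel] at h5
    linarith

/-- The path is bent to reach `x` at time `s`, starting at `t - τ`. The assumption on `φ` includes
the prefactor `Γ + 2 + 3 D Γ`, so all dependence on `q` and `C` sits in `c₁` and the constant is 4.
-/
theorem IsViscositySolution.sub_le_time
    (hu : IsViscositySolution (fun x t p => G (x, t) p) u) (h : IsDualPair F G n q N₁ C)
    (hN₁ : 1 < N₁) (hq : 1 < q) {D δ Γ c₁ : ℝ}
    (hD : D = |C| * 2 ^ q) (hΓ : 1 ≤ Γ) (hδ : Γ ^ (q - 1) * δ = 1) (hDδ : 3 * (D * δ) ≤ 1 / (2 * N₁))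
    (hc₁ : 0 ≤ c₁) (hφ : ∀ r, 2 ≤ r → (Γ + 2 + 3 * (D * Γ)) *
      (2 * N₁ * (7 + 3 * (D * Γ)) * (6 * N₁ * Γ)) *
      Real.exp ((Real.log (2 * N₁ * (7 + 3 * (D * Γ))) + 1) * √(Real.log r)) ≤ phi c₁ q r)
    (x : Space d) {s t : ℝ} (hs : 0 < s) (hst : s < t) :
    u x s - u x t ≤ 4 * ((t - s) * phi c₁ q (t / (t - s)) * (t / s) ^ (q - 1) *
      (cutoff N₁ q n t ^ q + supAverage n (t - tauTime c₁ q t s) t)) := by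
  have hN₁0 : 0 < N₁ := by linarith
  have hD0 : 0 ≤ D := by rw [hD]; positivity
  have hDΓ : 0 ≤ D * Γ := by positivity
  have ht : 0 < t := hs.trans hst
  have hσ : 0 < t - s := sub_pos.2 hst
  have hr1 : 1 ≤ t / (t - s) := by rw [le_div_iff₀ hσ]; linarith
  have hτd : tauTime c₁ q t s = (t - s) * phi c₁ q (t / (t - s)) := rfl
  rw [hτd]
  set r := t / (t - s) with hr
  have hφ1 : 1 ≤ phi c₁ q r := one_le_phi hc₁ hr1
  set τ := (t - s) * phi c₁ q r with hτ
  have hmτ : t - s ≤ τ := le_mul_of_one_le_right hσ.le hφ1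
  have hτ0 : 0 < τ := by linarith
  obtain ⟨hA1, hA2, hA3⟩ := h.average_bounds hN₁ hq ht hτ0
  set A := cutoff N₁ q n t ^ q + supAverage n (t - τ) t with hA
  have hts : 1 ≤ (t / s) ^ (q - 1) :=
    Real.one_le_rpow (by rw [le_div_iff₀ hs]; linarith) (by linarith)
  have hτA : τ ≤ τ * A := le_mul_of_one_le_right hτ0.le hA1
  suffices hmain : u x s - u x t ≤ 4 * (τ * A) by
    refine hmain.trans ?_
    have : τ * 1 * A ≤ τ * (t / s) ^ (q - 1) * A := by gcongr
    linarith
  rcases le_or_gt t (2 * τ) with htτ | htτ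
  · have h1 := (abs_le.1 (hu.abs_le_integral h hN₁0 hq x ht)).1
    have h2 := (abs_le.1 (hu.abs_le_integral h hN₁0 hq x hs)).2
    have h3 : A * t ≤ A * (2 * τ) := by gcongr
    have h4 : ∫ r in (0 : ℝ)..s, n r ≤ ∫ r in (0 : ℝ)..t, n r :=
      intervalIntegral.integral_mono_interval le_rfl hs.le hst.le
        (ae_of_all _ fun r => h.nonneg r) (h.intervalIntegrable _ _)
    linarith
  · have hr2 : 2 ≤ r := by rw [hr, le_div_iff₀ hσ]; linarith
    obtain ⟨α, hα, hact⟩ := hu.exists_action_lt h hN₁0 hq x ht hσ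
    have hE := hu.energy_le_exp h hN₁ hq hα hact.le hD hΓ hδ hDδ hτ0 hmτ hA1 hA3 (by linarith)
      hr1 (by
        have : (t - s) * r = t := by rw [hr]; field_simp
        have : (t - s) * r ≤ τ * r := by gcongr
        linarith)
    have hK := hφ r hr2
    have hKe1 : 1 ≤ 2 * N₁ * (7 + 3 * (D * Γ)) * (6 * N₁ * Γ) *
        Real.exp ((Real.log (2 * N₁ * (7 + 3 * (D * Γ))) + 1) * √(Real.log r)) := by
      have h1 : 1 ≤ 2 * N₁ * (7 + 3 * (D * Γ)) := by nlinarith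
      have h2 : 1 ≤ 6 * N₁ * Γ := by nlinarith
      have h3 := Real.log_nonneg h1
      have h4 : 1 ≤ Real.exp ((Real.log (2 * N₁ * (7 + 3 * (D * Γ))) + 1) * √(Real.log r)) :=
        Real.one_le_exp (by positivity)
      exact one_le_mul_of_one_le_of_one_le (one_le_mul_of_one_le_of_one_le h1 h2) h4
    rw [mul_assoc] at hK
    set e := 2 * N₁ * (7 + 3 * (D * Γ)) * (6 * N₁ * Γ) *
        Real.exp ((Real.log (2 * N₁ * (7 + 3 * (D * Γ))) + 1) * √(Real.log r)) with he
    have hDΓe : D * Γ * 1 ≤ D * Γ * e := by gcongr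
    have hΓe : Γ * 1 ≤ Γ * e := by gcongr
    -- This makes the window `[t - τ, s]` at least `Γ` times longer than `[s, t]` and at least half
    -- of `τ`; the next bound makes the drift cost at most `τ * A`.
    have hφΓ : Γ + 2 ≤ phi c₁ q r := by linarith
    have hφD : 3 * (D * Γ * e) ≤ phi c₁ q r := by linarith
    have hτΓ : (t - s) * (Γ + 2) ≤ τ := by rw [hτ]; gcongr
    have hsa : s - (t - τ) = τ - (t - s) := by ring
    have h2τ : τ / 2 ≤ τ - (t - s) := by nlinarith
    have hmain := hu.le_add_of_earlier h hN₁0 hq hα hact.le (a := t - τ) (s := s) (by linarith) hst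
      hD hΓ hδ hDδ (by rw [hsa]; linarith)
    have hE0 : 0 ≤ ∫ r in s..t, ‖α r‖ ^ q :=
      intervalIntegral.integral_nonneg hst.le fun r _ => by positivity
    have hE1 : 0 ≤ 1 / (2 * N₁) * ∫ r in s..t, ‖α r‖ ^ q := by positivity
    have h5 := hA3 (t - τ) (by linarith) le_rfl
    rw [sub_sub_cancel] at h5
    rw [hsa] at hmain
    have hEd : (∫ r in (t - τ)..t, ‖α r‖ ^ q) / (τ - (t - s)) ≤ 2 * (e * A) := by
      rw [div_le_iff₀ (by linarith)]
      refine hE.trans ?_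
      have : e * A * (τ / 2) ≤ e * A * (τ - (t - s)) := by gcongr
      linarith
    have heA : 1 ≤ e * A := one_le_mul_of_one_le_of_one_le hKe1 hA1
    have h6 : D * Γ * (t - s) * ((∫ r in (t - τ)..t, ‖α r‖ ^ q) / (τ - (t - s)) + 1) ≤ τ * A := by
      calc _ ≤ D * Γ * (t - s) * (3 * (e * A)) := by gcongr; linarith
        _ = (t - s) * (3 * (D * Γ * e)) * A := by ring
        _ ≤ (t - s) * phi c₁ q r * A := by gcongr
        _ = τ * A := rfl
    linarith

end HJ

theorem theorem5p5 (d : ℕ) (N₁ : ℝ) (hN₁ : 1 < N₁) :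
    ∃ K : ℝ, 0 < K ∧ ∀ q : ℝ, 1 < q → ∀ C : ℝ, ∃ c₁ : ℝ, 0 < c₁ ∧ ∃ Kq : ℝ, 0 < Kq ∧
      ∀ (Ω Ω₀ : Type*) [MeasurableSpace Ω] [MeasurableSpace Ω₀]
        (P : MeasureTheory.Measure Ω) [MeasureTheory.IsProbabilityMeasure P]
        (X : Ω → HJ.Env d Ω₀) (H : HJ.Space d → Ω₀ → ℝ) (ν : (HJ.Space d → Ω₀) → ℝ),
        HJ.IsStationaryErgodicUnitRange P X →
        HJ.IsConvexHamiltonian H →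
        (∀ η : HJ.Space d → Ω₀, 1 ≤ ν η) →
        (∀ᵐ ω ∂P, HJ.LagrangianCond H ν q N₁ C (X ω)) →
        ∀ᵐ ω ∂P, ∀ u : HJ.Space d → ℝ → ℝ,
          HJ.IsViscositySolution (fun x t p => H p (X ω (x, t))) u →
          (∀ (x y : HJ.Space d) (t : ℝ), 0 < t →
            |u x t - u y t| ≤
              Kq * (‖x - y‖ * HJ.phi c₁ q ((t + ‖x - y‖) / ‖x - y‖) *
                (HJ.cutoff N₁ q (HJ.nuAt ν (X ω)) t ^ q +
                  HJ.supAverage (HJ.nuAt ν (X ω)) (t - HJ.tauSpace c₁ q x y t) t))) ∧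
          (∀ (x : HJ.Space d) (s t : ℝ), 0 < s → s < t →
            -(∫ r in s..t, HJ.nuAt ν (X ω) r) ≤ u x s - u x t ∧
            u x s - u x t ≤
              K * ((t - s) * HJ.phi c₁ q (t / (t - s)) * (t / s) ^ (q - 1) *
                (HJ.cutoff N₁ q (HJ.nuAt ν (X ω)) t ^ q +
                  HJ.supAverage (HJ.nuAt ν (X ω)) (t - HJ.tauTime c₁ q t s) t))) := by
  refine ⟨4, by norm_num, fun q hq C => ?_⟩
  obtain ⟨D, hD⟩ : ∃ D : ℝ, D = |C| * 2 ^ q := ⟨_, rfl⟩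
  have hD0 : 0 ≤ D := by rw [hD]; positivity
  obtain ⟨Γ, δ, hΓ, hδ, hDδ⟩ := HJ.exists_young_constants (by linarith : (0 : ℝ) < N₁) hq hD0
  have hDΓ : 0 ≤ D * Γ := by positivity
  have hlog : 0 ≤ Real.log (2 * N₁ * (7 + 3 * (D * Γ))) := Real.log_nonneg (by nlinarith)
  obtain ⟨c₁, hc₁, hφ⟩ := HJ.exists_mul_exp_sqrt_log_le_phi
    (K := (Γ + 2 + 3 * (D * Γ)) * (2 * N₁ * (7 + 3 * (D * Γ)) * (6 * N₁ * Γ)))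
    (c := Real.log (2 * N₁ * (7 + 3 * (D * Γ))) + 1) hq (by positivity) (by positivity)
  refine ⟨c₁, hc₁, 3 + 4 * D, by positivity, ?_⟩
  intro Ω Ω₀ _ _ P _ X H ν _ hH hν hL
  filter_upwards [hL] with ω hω u hu
  have h := hω.isDualPair hH hν
  have hsp := fun (x y : HJ.Space d) (t : ℝ) (ht : 0 < t) =>
    HJ.IsViscositySolution.sub_le_space hu h hN₁ hq hD hΓ hδ hDδ hc₁.le (fun r hr => by
      -- The spatial estimate needs only the weaker bound without the prefactor `Γ + 2 + 3 D Γ ≥ 1`,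
      -- so one `c₁` serves both.
      refine le_trans (mul_le_mul_of_nonneg_right ?_ (Real.exp_pos _).le) (hφ r hr)
      exact le_mul_of_one_le_left (by positivity) (by linarith)) x y ht
  refine ⟨fun x y t ht => ?_, fun x s t hs hst => ⟨?_, ?_⟩⟩
  · rw [abs_le]
    have h1 := hsp x y t ht
    have h2 := hsp y x t ht
    have h3 : HJ.tauSpace c₁ q y x t = HJ.tauSpace c₁ q x y t := by
      rw [HJ.tauSpace, norm_sub_rev y x, HJ.tauSpace]
    rw [h3, norm_sub_rev y x] at h2
    constructor <;> linarith
  · have := HJ.IsViscositySolution.le_add_integral_of_le hu h hq x hs.le hst.le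
    linarith
  · exact HJ.IsViscositySolution.sub_le_time hu h hN₁ hq hD hΓ hδ hDδ hc₁.le hφ x hs hst
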